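/- Let $k\ge 2$ be an integer, let $\Omega\subset\mathbb R^2$ be a bounded domain (nonempty, connected, open) whose boundary $\Gamma$ is of class $C^k$, and let $\gamma$ be a real number. We consider all finite conforming triangulations $\mathcal T_h$ made of closed straight-edged triangles with the following properties. Let $\Omega_h=\bigcup_{T\in\mathcal T_h}T$, let $\Gamma_h=\partial\Omega_h$, let $h_T$ and $\rho_T$ be the diameter and the inradius of $T$, and let $h=\max_T h_T$. All mesh vertices on $\Gamma_h$ belong to $\Gamma$, no triangle has more than one edge on $\Gamma_h$, and $h_T\le\gamma\rho_T$ for all $T\in\mathcal T_h$. Let $V_h$ be the space of continuous functions $v$ on $\Omega_h$ that vanish on $\Gamma_h$ and whose restriction to each $T\in\mathcal T_h$ is a polynomial of degree at most $k$. Let $W_h$ be the space of continuous functions $w$ on $\Omega_h$ that vanish at the mesh vertices on $\Gamma_h$, whose restriction to each $T\in\mathcal T_h$ is a polynomial $w_T$ of degree at most $k$, and which satisfy the following condition for each $T$ having an edge $e_T$ on $\Gamma_h$. Let $O_T$ be the vertex of $T$ opposite to $e_T$. For each of the $k-1$ points $M$ that subdivide $e_T$ into $k$ segments of equal length, $w_T(P)=0$,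 where $P$ is the point nearest to $M$ at which the line through $O_T$ and $M$ meets $\Gamma$. (The point $P$ may lie outside $T$; the polynomial expression $w_T$ is used there. If there is more than one nearest point, the condition is imposed at each of them; if the line does not meet $\Gamma$, there is no condition for this $M$.) Put $$a_h(w,v)=\int_{\Omega_h}\operatorname{grad}w\cdot\operatorname{grad}v,\qquad F_h(v)=\int_{\Omega_h}f\,v,$$ and let $\|\cdot\|_{0,h}$ be the norm of $L^2(\Omega_h)$. Then there is $h_0>0$, depending only on $\Omega$, $k$ and $\gamma$, such that for every such triangulation with $h\le h_0$ the following two statements hold. 1. For every $f$ that is integrable on $\Omega_h$ (in particular for every $f\in L^2(\Omega_h)$) there is a unique $u_h\in W_h$ with $a_h(u_h,v)=F_h(v)$ for all $v\in V_h$. 2. The inf-sup condition $$\sup_{v\in V_h\setminus\{0\}}\frac{a_h(w,v)}{\|\operatorname{grad}w\|_{0,h}\,\|\operatorname{grad}v\|_{0,h}}\ \ge\ \alpha\qquad\text{for all } w\in W_h\setminus\{0\}$$ holds, and the supremum is finite, with the constant $\alpha=\tfrac13>0$, which does not depend on $h$ or on the triangulation. -/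

import Mathlib

open scoped Topology

noncomputable section

namespace CurvedFEM

/-- The Euclidean plane. -/
abbrev Plane : Type := EuclideanSpace ℝ (Fin 2)

/-- A bounded plane domain (nonempty connected open set) with boundary of class `C^k`: near every
boundary point, after a rigid motion of the plane, the domain is the part of the plane above the
graph of a `C^k` function of one variable. -/
structure IsCkDomain (k : ℕ) (Ω : Set Plane) : Prop where
  isOpen : IsOpen Ω
  isConnected : IsConnected Ω
  isBounded : Bornology.IsBounded Ω
  boundary : ∀ x ∈ frontier Ω, ∃ (e : Plane ≃ᵃⁱ[ℝ] Plane) (φ : ℝ → ℝ), ContDiff ℝ (k : ℕ) φ ∧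
    ∀ᶠ y in 𝓝 x, (y ∈ Ω ↔ φ (e y 0) < e y 1)

/-- Polynomial functions of two variables of total degree at most `k`. -/
def IsPoly (k : ℕ) (p : Plane → ℝ) : Prop :=
  ∃ q : MvPolynomial (Fin 2) ℝ, q.totalDegree ≤ k ∧ ∀ x, p x = MvPolynomial.eval (fun i => x i) q

/-- The closed triangle (or segment) with the given set of vertices. -/
def hull (T : Finset Plane) : Set Plane := convexHull ℝ (T : Set Plane)

/-- The diameter `h_T`. -/
def diamT (T : Finset Plane) : ℝ := Metric.diam (hull T)

/-- The radius `ρ_T` of the inscribed circle: the largest radius of a disk contained in `T`. -/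
def inradius (T : Finset Plane) : ℝ :=
  sSup {r : ℝ | 0 ≤ r ∧ ∃ c, Metric.closedBall c r ⊆ hull T}

/-- The triangles of a mesh, given by their vertex sets. A mesh is a simplicial complex in the
plane, so that two of its triangles meet in a common face or not at all. -/
def triangles (K : Geometry.SimplicialComplex ℝ Plane) : Set (Finset Plane) :=
  {T | T ∈ K.faces ∧ T.card = 3}

/-- The edges of the triangle `T` lying on `Γ_h`, the boundary of the union `Ω_h = K.space` of
the mesh. The triangle `T` belongs to `S_h` if there is such an edge. -/
def boundaryEdges (K : Geometry.SimplicialComplex ℝ Plane) (T : Finset Plane) :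
    Set (Finset Plane) :=
  {e | e ⊆ T ∧ e.card = 2 ∧ hull e ⊆ frontier K.space}

/-- The mesh size `h`, the maximal diameter of the triangles. -/
def meshSize (K : Geometry.SimplicialComplex ℝ Plane) : ℝ := sSup (diamT '' triangles K)

/-- A finite conforming triangulation `K`, all of whose vertices on the boundary of the polygon
`Ω_h = K.space` lie on the boundary of `Ω`, none of whose triangles has more than one edge on the
boundary of `Ω_h`, and all of whose triangles have chunkiness `h_T / ρ_T ≤ γ`. -/
structure IsMesh (Ω : Set Plane) (γ : ℝ) (K : Geometry.SimplicialComplex ℝ Plane) : Prop where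
  finite : K.faces.Finite
  nonempty : K.faces.Nonempty
  /-- every face is a face of a triangle -/
  pure : ∀ s ∈ K.faces, ∃ T ∈ triangles K, s ⊆ T
  vertices_mem : ∀ x ∈ K.vertices, x ∈ frontier K.space → x ∈ frontier Ω
  boundaryEdges_subsingleton : ∀ T ∈ triangles K, (boundaryEdges K T).Subsingleton
  regular : ∀ T ∈ triangles K, diamT T ≤ γ * inradius T

/-- `P` is the intersection nearest to `M` of the line through `O` and `M` with `∂Ω`. -/
def IsNearestIntersection (Ω : Set Plane) (O M P : Plane) : Prop :=
  P ∈ frontier Ω ∧ P ∈ line[ℝ, O, M] ∧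
    ∀ Q ∈ frontier Ω, Q ∈ line[ℝ, O, M] → dist M P ≤ dist M Q

/-- `P` is one of the nodes on `∂Ω` attached to the triangle `T`. Let `e` be an edge of `T` on
the boundary of `Ω_h`, with end points `A` and `B`, and let `O` be the opposite vertex. The
points `M = A + (j / k) (B - A)`, `0 < j < k`, subdivide `e` into `k` segments of equal length,
and the node `P` is the nearest intersection with `∂Ω` of the line through `O` and `M`. -/
def IsCurvedNode (Ω : Set Plane) (k : ℕ) (K : Geometry.SimplicialComplex ℝ Plane)
    (T : Finset Plane) (P : Plane) : Prop :=
  ∃ e ∈ boundaryEdges K T, ∃ A ∈ e, ∃ B ∈ e, A ≠ B ∧ ∃ O ∈ T, O ∉ e ∧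
    ∃ j : ℕ, 0 < j ∧ j < k ∧
      IsNearestIntersection Ω O (AffineMap.lineMap A B ((j : ℝ) / k)) P

/-- The Lagrange space `V_h`: functions on `Ω_h` (extended by zero to the plane) that are
continuous on `Ω_h`, vanish on its boundary, and agree on every triangle with a polynomial of
degree at most `k`. -/
def V (k : ℕ) (K : Geometry.SimplicialComplex ℝ Plane) : Submodule ℝ (Plane → ℝ) where
  carrier := {v | (∀ x ∉ K.space, v x = 0) ∧ ContinuousOn v K.space ∧
    (∀ x ∈ frontier K.space, v x = 0) ∧
    ∀ T ∈ triangles K, ∃ p, IsPoly k p ∧ Set.EqOn v p (hull T)}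
  zero_mem' := ⟨fun _ _ => rfl, continuousOn_const, fun _ _ => rfl, fun _ _ =>
    ⟨0, ⟨0, by simp, by simp⟩, fun _ _ => rfl⟩⟩
  add_mem' := by
    rintro v w ⟨h1, h2, h3, h4⟩ ⟨g1, g2, g3, g4⟩
    refine ⟨fun x hx => by simp [h1 x hx, g1 x hx], h2.add g2,
      fun x hx => by simp [h3 x hx, g3 x hx], fun T hT => ?_⟩
    obtain ⟨p, ⟨a, ha, ha'⟩, hp⟩ := h4 T hT
    obtain ⟨q, ⟨b, hb, hb'⟩, hq⟩ := g4 T hT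
    exact ⟨p + q, ⟨a + b, (MvPolynomial.totalDegree_add a b).trans (max_le ha hb),
      fun x => by simp [ha', hb']⟩, fun x hx => by simp [hp hx, hq hx]⟩
  smul_mem' := by
    rintro c v ⟨h1, h2, h3, h4⟩
    refine ⟨fun x hx => by simp [h1 x hx], h2.const_smul c,
      fun x hx => by simp [h3 x hx], fun T hT => ?_⟩
    obtain ⟨p, ⟨a, ha, ha'⟩, hp⟩ := h4 T hT
    exact ⟨c • p, ⟨c • a, (MvPolynomial.totalDegree_smul_le c a).trans ha,
      fun x => by simp [ha']⟩, fun x hx => by simp [hp hx]⟩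

/-- The trial space `W_h`: functions on `Ω_h` that are continuous on `Ω_h`, vanish at the mesh
vertices on its boundary, and agree on every triangle `T` with a polynomial of degree at most `k`
that vanishes at the nodes on `∂Ω` attached to `T`. These nodes may lie outside `T`, and the
value used there is that of the polynomial expression of the function in `T`. As for `V`, the
function is set to zero off `Ω_h`, only to make it a function on the plane. -/
def W (Ω : Set Plane) (k : ℕ) (K : Geometry.SimplicialComplex ℝ Plane) :
    Submodule ℝ (Plane → ℝ) where
  carrier := {w | (∀ x ∉ K.space, w x = 0) ∧ ContinuousOn w K.space ∧
    (∀ x ∈ K.vertices, x ∈ frontier K.space → w x = 0) ∧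
    ∀ T ∈ triangles K, ∃ p, IsPoly k p ∧ Set.EqOn w p (hull T) ∧
      ∀ P, IsCurvedNode Ω k K T P → p P = 0}
  zero_mem' := ⟨fun _ _ => rfl, continuousOn_const, fun _ _ _ => rfl, fun _ _ =>
    ⟨0, ⟨0, by simp, by simp⟩, fun _ _ => rfl, fun _ _ => rfl⟩⟩
  add_mem' := by
    rintro v w ⟨h1, h2, h3, h4⟩ ⟨g1, g2, g3, g4⟩
    refine ⟨fun x hx => by simp [h1 x hx, g1 x hx], h2.add g2,
      fun x hx hx' => by simp [h3 x hx hx', g3 x hx hx'], fun T hT => ?_⟩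
    obtain ⟨p, ⟨a, ha, ha'⟩, hp, hp'⟩ := h4 T hT
    obtain ⟨q, ⟨b, hb, hb'⟩, hq, hq'⟩ := g4 T hT
    exact ⟨p + q, ⟨a + b, (MvPolynomial.totalDegree_add a b).trans (max_le ha hb),
      fun x => by simp [ha', hb']⟩, fun x hx => by simp [hp hx, hq hx],
      fun P hP => by simp [hp' P hP, hq' P hP]⟩
  smul_mem' := by
    rintro c v ⟨h1, h2, h3, h4⟩
    refine ⟨fun x hx => by simp [h1 x hx], h2.const_smul c,
      fun x hx hx' => by simp [h3 x hx hx'], fun T hT => ?_⟩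
    obtain ⟨p, ⟨a, ha, ha'⟩, hp, hp'⟩ := h4 T hT
    exact ⟨c • p, ⟨c • a, (MvPolynomial.totalDegree_smul_le c a).trans ha,
      fun x => by simp [ha']⟩, fun x hx => by simp [hp hx],
      fun P hP => by simp [hp' P hP]⟩

/-- `a_h(w, v)`, the integral of `grad w · grad v` over `Ω_h`. The functions in `V_h` and `W_h`
are smooth in the interior of every triangle, that is, almost everywhere in `Ω_h`. -/
def aForm (K : Geometry.SimplicialComplex ℝ Plane) (w v : Plane → ℝ) : ℝ :=
  ∫ x in K.space, inner ℝ (gradient w x) (gradient v x)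

/-- `F_h(v)`, the integral of `f v` over `Ω_h`. -/
def load (K : Geometry.SimplicialComplex ℝ Plane) (f v : Plane → ℝ) : ℝ :=
  ∫ x in K.space, f x * v x

/-- The norm of `grad w` in `L²(Ω_h)`. -/
def gradNorm (K : Geometry.SimplicialComplex ℝ Plane) (w : Plane → ℝ) : ℝ :=
  Real.sqrt (∫ x in K.space, ‖gradient w x‖ ^ 2)

end CurvedFEM

end

noncomputable section

namespace CurvedFEM

open MeasureTheory

/-! ### Polynomials in the plane and an inverse inequality for gradients -/

section Polynomials

namespace IsPoly

theorem mono {k l : ℕ} {p : Plane → ℝ} (hp : IsPoly k p) (h : k ≤ l) : IsPoly l p := by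
  obtain ⟨q, hq, hp⟩ := hp
  exact ⟨q, hq.trans h, hp⟩

theorem const (k : ℕ) (c : ℝ) : IsPoly k fun _ => c := ⟨MvPolynomial.C c, by simp, by simp⟩

theorem coord (i : Fin 2) : IsPoly 1 fun x => x i :=
  ⟨MvPolynomial.X i, by simp, by simp⟩

theorem add {k : ℕ} {p q : Plane → ℝ} (hp : IsPoly k p) (hq : IsPoly k q) :
    IsPoly k fun x => p x + q x := by
  obtain ⟨a, ha, hp⟩ := hp
  obtain ⟨b, hb, hq⟩ := hq
  exact ⟨a + b, (MvPolynomial.totalDegree_add a b).trans (max_le ha hb), by simp [hp, hq]⟩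

theorem mul {k l : ℕ} {p q : Plane → ℝ} (hp : IsPoly k p) (hq : IsPoly l q) :
    IsPoly (k + l) fun x => p x * q x := by
  obtain ⟨a, ha, hp⟩ := hp
  obtain ⟨b, hb, hq⟩ := hq
  exact ⟨a * b, (MvPolynomial.totalDegree_mul a b).trans (add_le_add ha hb), by simp [hp, hq]⟩

theorem const_mul {k : ℕ} {p : Plane → ℝ} (c : ℝ) (hp : IsPoly k p) :
    IsPoly k fun x => c * p x :=
  ((const 0 c).mul hp).mono (by omega)

theorem sub {k : ℕ} {p q : Plane → ℝ} (hp : IsPoly k p) (hq : IsPoly k q) :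
    IsPoly k fun x => p x - q x := by
  simpa [sub_eq_add_neg] using hp.add (hq.const_mul (-1))

theorem prod {ι : Type*} (s : Finset ι) {k : ι → ℕ} {p : ι → Plane → ℝ}
    (hp : ∀ i ∈ s, IsPoly (k i) (p i)) : IsPoly (∑ i ∈ s, k i) fun x => ∏ i ∈ s, p i x := by
  classical
  induction s using Finset.induction_on with
  | empty => simpa using const 0 1
  | insert a s ha ih =>
    simp only [Finset.prod_insert ha, Finset.sum_insert ha]
    exact (hp a (by simp)).mul (ih fun i hi => hp i (by simp [hi]))

theorem sum {ι : Type*} (s : Finset ι) {k : ℕ} {p : ι → Plane → ℝ}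
    (hp : ∀ i ∈ s, IsPoly k (p i)) : IsPoly k fun x => ∑ i ∈ s, p i x := by
  classical
  induction s using Finset.induction_on with
  | empty => simpa using const k 0
  | insert a s ha ih =>
    simp only [Finset.sum_insert ha]
    exact (hp a (by simp)).add (ih fun i hi => hp i (by simp [hi]))

theorem pow {k : ℕ} {p : Plane → ℝ} (hp : IsPoly k p) (n : ℕ) :
    IsPoly (n * k) fun x => p x ^ n := by
  simpa using prod (Finset.range n) (k := fun _ => k) (p := fun _ => p) fun _ _ => hp

/-- Substituting polynomials of degree one. -/
theorem comp {k : ℕ} {p : Plane → ℝ} (hp : IsPoly k p) {g : Plane → Plane}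
    (hg : ∀ i, IsPoly 1 fun x => g x i) : IsPoly k fun x => p (g x) := by
  obtain ⟨q, hq, hp⟩ := hp
  simp only [hp, MvPolynomial.eval_eq']
  refine sum _ fun m hm => const_mul _ ?_
  refine (prod Finset.univ fun i _ => (hg i).pow (m i)).mono ?_
  refine le_trans ?_ hq
  refine le_trans ?_ (MvPolynomial.le_totalDegree hm)
  rw [Finsupp.sum_fintype _ _ (by simp)]
  simp

theorem contDiff {k : ℕ} {p : Plane → ℝ} (hp : IsPoly k p) : ContDiff ℝ 1 p := by
  obtain ⟨q, -, hp⟩ := hp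
  rw [funext hp]
  simp only [MvPolynomial.eval_eq']
  fun_prop

theorem continuous {k : ℕ} {p : Plane → ℝ} (hp : IsPoly k p) : Continuous p :=
  hp.contDiff.continuous

theorem differentiable {k : ℕ} {p : Plane → ℝ} (hp : IsPoly k p) : Differentiable ℝ p :=
  hp.contDiff.differentiable (by simp)

/-- An affine function is a polynomial of degree one. -/
theorem affine (f : Plane →ᵃ[ℝ] ℝ) : IsPoly 1 f := by
  have h : ∀ x, f x = f 0 + ∑ i, f.linear (EuclideanSpace.single i 1) * x i := by
    intro x
    have h1 : x = ∑ i, x i • EuclideanSpace.single i (1 : ℝ) := by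
      ext j; fin_cases j <;> simp [Fin.sum_univ_two]
    have h2 := f.map_vadd 0 x
    simp only [vadd_eq_add, add_zero] at h2
    rw [h2, add_comm]
    congr 1
    conv_lhs => rw [h1]
    simp [mul_comm]
  rw [funext h]
  exact (const 1 _).add (sum _ fun i _ => (coord i).const_mul _)

end IsPoly

theorem hasFDerivAt_eval (q : MvPolynomial (Fin 2) ℝ) (x : Plane) :
    HasFDerivAt (fun y : Plane => MvPolynomial.eval (fun i => y i) q)
      (∑ i, MvPolynomial.eval (fun j => x j) (MvPolynomial.pderiv i q) •
        EuclideanSpace.proj (𝕜 := ℝ) i) x := by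
  induction q using MvPolynomial.induction_on with
  | C a => simpa using hasFDerivAt_const a x
  | add p q hp hq =>
    simp only [map_add, add_smul, Finset.sum_add_distrib]
    exact hp.add hq
  | mul_X p i hp =>
    have h := hp.mul (EuclideanSpace.proj (𝕜 := ℝ) i).hasFDerivAt
    simp only [map_mul, MvPolynomial.eval_X]
    refine h.congr_fderiv ?_
    ext v
    fin_cases i <;> simp [Fin.sum_univ_two, MvPolynomial.pderiv_X] <;> ring

theorem norm_gradient_sq_eval (q : MvPolynomial (Fin 2) ℝ) (x : Plane) :
    ‖gradient (fun y : Plane => MvPolynomial.eval (fun i => y i) q) x‖ ^ 2 =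
      ∑ i, MvPolynomial.eval (fun j => x j) (MvPolynomial.pderiv i q) ^ 2 := by
  have h : HasGradientAt (fun y : Plane => MvPolynomial.eval (fun i => y i) q)
      (WithLp.toLp 2 fun i => MvPolynomial.eval (fun j => x j) (MvPolynomial.pderiv i q)) x := by
    rw [hasGradientAt_iff_hasFDerivAt]
    refine (hasFDerivAt_eval q x).congr_fderiv ?_
    ext v
    simp [Fin.sum_univ_two, PiLp.inner_apply, mul_comm]
  rw [h.gradient, EuclideanSpace.norm_sq_eq]
  simp

theorem continuous_eval (q : MvPolynomial (Fin 2) ℝ) :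
    Continuous fun y : Plane => MvPolynomial.eval (fun i => y i) q :=
  (MvPolynomial.continuous_eval q).comp (PiLp.continuous_ofLp 2 _)

/-- The disk contains the square `(0, 1/2)²`, a product of infinite sets. -/
theorem eq_zero_of_eval_ball {q : MvPolynomial (Fin 2) ℝ}
    (h : ∀ x : Plane, x ∈ Metric.ball 0 1 → MvPolynomial.eval (fun i => x i) q = 0) : q = 0 := by
  refine MvPolynomial.funext_set (fun _ => Set.Ioo (0 : ℝ) (1 / 2))
    (fun _ => Set.Ioo_infinite (by norm_num)) fun x hx => ?_
  have := h (WithLp.toLp 2 x) ?_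
  · simpa using this
  · rw [mem_ball_zero_iff]
    have h0 := hx 0 trivial
    have h1 := hx 1 trivial
    simp only [Set.mem_Ioo] at h0 h1
    have : ‖WithLp.toLp 2 x‖ ^ 2 < 1 := by
      rw [EuclideanSpace.norm_sq_eq, Fin.sum_univ_two]
      simp only [Real.norm_eq_abs, sq_abs]
      nlinarith
    nlinarith [norm_nonneg (WithLp.toLp 2 x)]

/-- In a finite-dimensional space of polynomials, the maximum on a disk is bounded by the
`L²` norm on the unit disk. -/
theorem exists_sq_eval_le_integral (E : Submodule ℝ (MvPolynomial (Fin 2) ℝ))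
    [FiniteDimensional ℝ E] (L : ℝ) :
    ∃ C : ℝ, 0 < C ∧ ∀ q ∈ E, ∀ x : Plane, ‖x‖ ≤ L →
      MvPolynomial.eval (fun i => x i) q ^ 2 ≤
        C * ∫ y : Plane in Metric.closedBall 0 1, MvPolynomial.eval (fun i => y i) q ^ 2 := by
  let b := Module.finBasis ℝ E
  set n := Module.finrank ℝ E
  let m : Fin n → Plane → ℝ := fun i y => MvPolynomial.eval (fun j => y j) (b i : MvPolynomial _ ℝ)
  have hm : ∀ i, Continuous (m i) := fun i => continuous_eval _
  let P : EuclideanSpace ℝ (Fin n) → Plane → ℝ := fun c y => ∑ i, c i * m i y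
  have hP : ∀ c, Continuous (P c) := fun c => by fun_prop
  have hint : ∀ f : Plane → ℝ, Continuous f → IntegrableOn f (Metric.closedBall 0 1) :=
    fun f hf => hf.continuousOn.integrableOn_compact (isCompact_closedBall _ _)
  let N : EuclideanSpace ℝ (Fin n) → ℝ := fun c => ∫ y in Metric.closedBall 0 1, P c y ^ 2
  -- Written as a quadratic form in the coefficients, `N` is visibly continuous and homogeneous of
  -- degree two.
  have hN : N = fun c => ∑ i, ∑ j, c i * c j *
      ∫ y in Metric.closedBall 0 1, m i y * m j y := by
    funext c
    have : ∀ y, P c y ^ 2 = ∑ i, ∑ j, c i * c j * (m i y * m j y) := by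
      intro y
      simp only [P, sq, Finset.sum_mul_sum]
      exact Finset.sum_congr rfl fun i _ => Finset.sum_congr rfl fun j _ => by ring
    simp only [N, this]
    rw [integral_finsetSum _ fun i _ => hint _ (by fun_prop)]
    refine Finset.sum_congr rfl fun i _ => ?_
    rw [integral_finsetSum _ fun i _ => hint _ (by fun_prop)]
    simp [integral_const_mul]
  have hNc : Continuous N := by rw [hN]; fun_prop
  have hPE : ∀ c : EuclideanSpace ℝ (Fin n), ∀ y : Plane, P c y =
      MvPolynomial.eval (fun j => y j) ((∑ i, c i • b i : E) : MvPolynomial (Fin 2) ℝ) := by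
    intro c y
    simp [P, m, MvPolynomial.smul_eval]
  have hpos : ∀ c, c ≠ 0 → 0 < N c := by
    intro c hc
    have h0 : 0 ≤ N c := integral_nonneg fun y => sq_nonneg _
    refine lt_of_le_of_ne h0 fun h => hc ?_
    have hz : ∀ y ∈ Metric.ball (0 : Plane) 1, P c y = 0 := by
      by_contra! hcon
      obtain ⟨y, hy, hne⟩ := hcon
      have hpos : 0 < N c := by
        refine (setIntegral_pos_iff_support_of_nonneg_ae ?_ (hint _ (by fun_prop))).2 ?_
        · exact Filter.Eventually.of_forall fun y => sq_nonneg _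
        · refine lt_of_lt_of_le (IsOpen.measure_pos volume
            (U := Metric.ball 0 1 ∩ {y | P c y ≠ 0}) ?_ ⟨y, hy, hne⟩) (measure_mono ?_)
          · exact Metric.isOpen_ball.inter (isOpen_ne_fun (hP c) continuous_const)
          · exact fun z hz => ⟨by simpa using hz.2, Metric.ball_subset_closedBall hz.1⟩
      exact hpos.ne h
    have hq := eq_zero_of_eval_ball (q := ((∑ i, c i • b i : E) : MvPolynomial (Fin 2) ℝ))
      fun x hx => by rw [← hPE]; exact hz x hx
    have hli := Fintype.linearIndependent_iff.1 b.linearIndependent c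
      (Subtype.ext hq)
    ext i
    exact hli i
  -- The minimum of the positive definite form on the unit sphere is a coercivity constant. The
  -- sphere is empty when `E` is zero.
  obtain ⟨μ, hμ, hμN⟩ : ∃ μ > 0, ∀ c, μ * ‖c‖ ^ 2 ≤ N c := by
    have hhom : ∀ (t : ℝ) c, N (t • c) = t ^ 2 * N c := by
      intro t c
      simp only [hN, Finset.mul_sum]
      refine Finset.sum_congr rfl fun i _ => Finset.sum_congr rfl fun j _ => ?_
      simp; ring
    rcases (Metric.sphere (0 : EuclideanSpace ℝ (Fin n)) 1).eq_empty_or_nonempty with he | hne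
    · refine ⟨1, one_pos, fun c => ?_⟩
      have : c = 0 := by
        by_contra hc
        have : (‖c‖⁻¹ • c) ∈ Metric.sphere (0 : EuclideanSpace ℝ (Fin n)) 1 := by
          simp [norm_smul, norm_ne_zero_iff.2 hc]
        simp [he] at this
      subst this
      simpa using integral_nonneg fun y => sq_nonneg _
    · obtain ⟨c₀, hc₀, hmin⟩ := (isCompact_sphere _ _).exists_isMinOn hne hNc.continuousOn
      have hc₀' : c₀ ≠ 0 := by rintro rfl; simp at hc₀
      refine ⟨N c₀, hpos _ hc₀', fun c => ?_⟩
      by_cases hc : c = 0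
      · subst hc
        simpa using integral_nonneg fun y => sq_nonneg _
      have h1 := hmin (a := ‖c‖⁻¹ • c) (by simp [norm_smul, norm_ne_zero_iff.2 hc])
      simp only [Set.mem_ofPred_eq] at h1
      rw [hhom] at h1
      have h2 : 0 < ‖c‖ := norm_pos_iff.2 hc
      calc N c₀ * ‖c‖ ^ 2 ≤ (‖c‖⁻¹ ^ 2 * N c) * ‖c‖ ^ 2 := by gcongr
        _ = N c := by field_simp
  obtain ⟨S, hS⟩ : ∃ S : ℝ, ∀ y : Plane, ‖y‖ ≤ L → ∑ i, m i y ^ 2 ≤ S := by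
    obtain ⟨S, hS⟩ := (isCompact_closedBall (0 : Plane) L).bddAbove_image
      (f := fun y => ∑ i, m i y ^ 2) (by fun_prop)
    exact ⟨S, fun y hy => hS ⟨y, by simpa using hy, rfl⟩⟩
  refine ⟨(|S| + 1) / μ, by positivity, fun q hq x hx => ?_⟩
  let c : EuclideanSpace ℝ (Fin n) := WithLp.toLp 2 fun i => b.repr ⟨q, hq⟩ i
  have hc : ((∑ i, c i • b i : E) : MvPolynomial (Fin 2) ℝ) = q := by
    have := b.sum_repr ⟨q, hq⟩
    simp only [c]
    rw [this]
  have hPq : ∀ y : Plane, MvPolynomial.eval (fun i => y i) q = P c y := fun y => by rw [hPE, hc]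
  simp only [hPq]
  have h1 : P c x ^ 2 ≤ (∑ i, c i ^ 2) * ∑ i, m i x ^ 2 :=
    Finset.sum_mul_sq_le_sq_mul_sq _ _ _
  have h2 : ∑ i, c i ^ 2 = ‖c‖ ^ 2 := by simp [EuclideanSpace.norm_sq_eq]
  rw [h2] at h1
  calc P c x ^ 2 ≤ ‖c‖ ^ 2 * ∑ i, m i x ^ 2 := h1
    _ ≤ ‖c‖ ^ 2 * (|S| + 1) := by
        gcongr; exact (hS x hx).trans ((le_abs_self S).trans (by linarith))
    _ = (|S| + 1) / μ * (μ * ‖c‖ ^ 2) := by field_simp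
    _ ≤ _ := by gcongr; exact hμN c

/-- The `i`-th partial derivatives of polynomials of degree at most `k` form a finite-dimensional
space, the image of one under a linear map, so each component of the gradient is covered by
`exists_sq_eval_le_integral`. -/
theorem exists_norm_gradient_sq_le_integral_unit (k : ℕ) (L : ℝ) :
    ∃ C : ℝ, 0 < C ∧ ∀ p : Plane → ℝ, IsPoly k p → ∀ x : Plane, ‖x‖ ≤ L →
      ‖gradient p x‖ ^ 2 ≤ C * ∫ y : Plane in Metric.closedBall 0 1, ‖gradient p y‖ ^ 2 := by
  have h := fun i : Fin 2 => exists_sq_eval_le_integral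
    ((MvPolynomial.restrictTotalDegree (Fin 2) ℝ k).map
      (MvPolynomial.pderiv i : Derivation ℝ _ _).toLinearMap) L
  choose C hC h using h
  refine ⟨C 0 + C 1, by linarith [hC 0, hC 1], ?_⟩
  rintro p ⟨q, hq, hp⟩ x hx
  rw [funext hp]
  simp only [norm_gradient_sq_eval, Fin.sum_univ_two]
  have hint : ∀ i : Fin 2, IntegrableOn (fun y : Plane =>
      MvPolynomial.eval (fun j => y j) (MvPolynomial.pderiv i q) ^ 2) (Metric.closedBall 0 1) :=
    fun i => ((continuous_eval _).pow 2).continuousOn.integrableOn_compact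
      (isCompact_closedBall _ _)
  rw [integral_add (hint 0) (hint 1)]
  have h' := fun i => h i (MvPolynomial.pderiv i q)
    ⟨q, (MvPolynomial.mem_restrictTotalDegree _ _ _).2 hq, rfl⟩ x hx
  have h0 := h' 0
  have h1 := h' 1
  have n0 : 0 ≤ ∫ y : Plane in Metric.closedBall 0 1,
    MvPolynomial.eval (fun j => y j) (MvPolynomial.pderiv 0 q) ^ 2 :=
    integral_nonneg fun y => sq_nonneg _
  have n1 : 0 ≤ ∫ y : Plane in Metric.closedBall 0 1,
    MvPolynomial.eval (fun j => y j) (MvPolynomial.pderiv 1 q) ^ 2 :=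
    integral_nonneg fun y => sq_nonneg _
  nlinarith [mul_nonneg (hC 0).le n1, mul_nonneg (hC 1).le n0]

theorem norm_gradient (p : Plane → ℝ) (x : Plane) : ‖gradient p x‖ = ‖fderiv ℝ p x‖ := by
  simp [gradient]

/-- The inverse inequality: the gradient of a polynomial on a disk is controlled by its `L²` norm
on a concentric disk. -/
theorem exists_norm_gradient_sq_le_integral (k : ℕ) (L : ℝ) :
    ∃ C : ℝ, 0 < C ∧ ∀ p : Plane → ℝ, IsPoly k p → ∀ (c : Plane) (r : ℝ), 0 < r →
      ∀ x : Plane, dist x c ≤ L * r →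
        r ^ 2 * ‖gradient p x‖ ^ 2 ≤
          C * ∫ y : Plane in Metric.closedBall c r, ‖gradient p y‖ ^ 2 := by
  obtain ⟨C, hC, h⟩ := exists_norm_gradient_sq_le_integral_unit k L
  refine ⟨C, hC, fun p hp c r hr x hx => ?_⟩
  -- Pulling back to the unit disk suffices: in the plane the Dirichlet integral is invariant under
  -- dilations, so only the pointwise gradient acquires a factor `r ^ 2`.
  have hg : IsPoly k fun y => p (c + r • y) := hp.comp (g := fun y => c + r • y) fun i => by
    simpa using (IsPoly.const 1 (c i)).add ((IsPoly.coord i).const_mul r)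
  have hgrad : ∀ y, ‖gradient (fun y => p (c + r • y)) y‖ ^ 2 =
      r ^ 2 * ‖gradient p (c + r • y)‖ ^ 2 := by
    intro y
    rw [norm_gradient, norm_gradient]
    have h1 : HasFDerivAt (fun y : Plane => c + r • y)
        (r • ContinuousLinearMap.id ℝ Plane) y :=
      ((hasFDerivAt_id y).const_smul r).const_add c
    have h2 := (hp.differentiable (c + r • y)).hasFDerivAt.comp y h1
    have h3 : fderiv ℝ (fun y => p (c + r • y)) y = r • fderiv ℝ p (c + r • y) := by
      refine h2.fderiv.trans ?_
      ext v; simp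
    rw [h3, norm_smul, Real.norm_eq_abs, mul_pow, sq_abs]
  have h1 := h _ hg (r⁻¹ • (x - c)) (by
    rw [norm_smul, norm_inv, Real.norm_eq_abs, abs_of_pos hr, ← dist_eq_norm,
      inv_mul_le_iff₀ hr]; linarith)
  simp only [hgrad] at h1
  rw [smul_inv_smul₀ hr.ne', add_sub_cancel] at h1
  refine h1.trans (le_of_eq ?_)
  congr 1
  rw [integral_const_mul]
  have e1 := Measure.setIntegral_comp_smul_of_pos volume
    (fun z : Plane => ‖gradient p (c + z)‖ ^ 2) (Metric.closedBall 0 1) hr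
  rw [e1]
  have hf : Module.finrank ℝ Plane = 2 := by simp
  rw [hf, smul_eq_mul, smul_unitClosedBall_of_nonneg hr.le, ← mul_assoc,
    mul_inv_cancel₀ (by positivity), one_mul]
  have e2 := (measurePreserving_add_left (volume : Measure Plane) c).setIntegral_preimage_emb
    (measurableEmbedding_addLeft c) (fun z => ‖gradient p z‖ ^ 2) (Metric.closedBall c r)
  rw [← e2]
  simp

end Polynomials

/-! ### Bubbles attached to one edge of a triangle -/

section EdgeBubbles

/-- The homogeneous polynomial of degree `k` in two variables that is one at the `j`-th of the
points `((k - i) / k, i / k)`, `0 ≤ i ≤ k`, and zero at the others. -/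
def edgeShape (k j : ℕ) (s t : ℝ) : ℝ :=
  ∏ i ∈ (Finset.range (k + 1)).erase j, ((j : ℝ) - i)⁻¹ * (((k : ℝ) - i) * t - i * s)

/-- There are exactly `k` factors, each linear in `(s, t)`. This homogeneity transports values along
rays from the vertex opposite to the edge. -/
theorem edgeShape_mul {k j : ℕ} (hj : j ≤ k) (u s t : ℝ) :
    edgeShape k j (u * s) (u * t) = u ^ k * edgeShape k j s t := by
  have hc : ((Finset.range (k + 1)).erase j).card = k := by
    rw [Finset.card_erase_of_mem (by simp; omega)]; simp
  unfold edgeShape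
  conv_rhs => rw [← hc, ← Finset.prod_const, hc, ← Finset.prod_mul_distrib]
  exact Finset.prod_congr rfl fun i _ => by ring

theorem edgeShape_zero_left {k j : ℕ} (hj : j < k) (t : ℝ) : edgeShape k j 0 t = 0 :=
  Finset.prod_eq_zero (i := k) (by simp; omega) (by simp)

theorem edgeShape_zero_right {k j : ℕ} (hj : 0 < j) (s : ℝ) : edgeShape k j s 0 = 0 :=
  Finset.prod_eq_zero (i := 0) (by simp; omega) (by simp)

/-- On the line `s + t = 1` the factors become `(l - i) / (j - i)`, those of the Lagrange basis. -/
theorem edgeShape_node {k j l : ℕ} (hk : 0 < k) (hl : l ≤ k) :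
    edgeShape k j (1 - (l : ℝ) / k) ((l : ℝ) / k) = if l = j then 1 else 0 := by
  have hk' : (k : ℝ) ≠ 0 := by positivity
  have h : ∀ i : ℕ, ((k : ℝ) - i) * ((l : ℝ) / k) - i * (1 - (l : ℝ) / k) = l - i := by
    intro i; field_simp; ring
  unfold edgeShape
  simp only [h]
  split_ifs with hlj
  · subst hlj
    refine Finset.prod_eq_one fun i hi => inv_mul_cancel₀ ?_
    rw [sub_ne_zero]
    exact_mod_cast (Finset.ne_of_mem_erase hi).symm
  · exact Finset.prod_eq_zero (i := l) (by simp [hlj]; omega) (by simp)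

theorem contDiff_edgeShape (k j : ℕ) :
    ContDiff ℝ 1 fun x : ℝ × ℝ => edgeShape k j x.1 x.2 := by
  unfold edgeShape
  fun_prop

/-- The polynomial on a triangle, homogeneous with respect to the vertex `b 0`, with the values
`a j` at the equidistant points in the interior of the edge from `b 1` to `b 2`, which vanishes
on the other two edges. -/
def edgeBubble (b : AffineBasis (Fin 3) ℝ Plane) (k : ℕ) (a : ℕ → ℝ) (x : Plane) : ℝ :=
  ∑ j ∈ Finset.Ioo 0 k, a j * edgeShape k j (b.coord 1 x) (b.coord 2 x)

theorem isPoly_edgeShape (b : AffineBasis (Fin 3) ℝ Plane) {k j : ℕ} (hj : j ≤ k) :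
    IsPoly k fun x => edgeShape k j (b.coord 1 x) (b.coord 2 x) := by
  unfold edgeShape
  refine (IsPoly.prod _ (k := fun _ => 1) fun i _ => ?_).mono ?_
  · exact (((IsPoly.affine (b.coord 2)).const_mul _).sub
      ((IsPoly.affine (b.coord 1)).const_mul _)).const_mul _
  · rw [Finset.sum_const, Finset.card_erase_of_mem (by simp; omega)]; simp

theorem isPoly_edgeBubble (b : AffineBasis (Fin 3) ℝ Plane) (k : ℕ) (a : ℕ → ℝ) :
    IsPoly k (edgeBubble b k a) :=
  IsPoly.sum _ fun _ hj => (isPoly_edgeShape b (Finset.mem_Ioo.1 hj).2.le).const_mul _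

theorem edgeBubble_of_coord_one {b : AffineBasis (Fin 3) ℝ Plane} {k : ℕ} {a : ℕ → ℝ} {x : Plane}
    (hx : b.coord 1 x = 0) : edgeBubble b k a x = 0 :=
  Finset.sum_eq_zero fun j hj => by
    rw [hx, edgeShape_zero_left (Finset.mem_Ioo.1 hj).2, mul_zero]

theorem edgeBubble_of_coord_two {b : AffineBasis (Fin 3) ℝ Plane} {k : ℕ} {a : ℕ → ℝ} {x : Plane}
    (hx : b.coord 2 x = 0) : edgeBubble b k a x = 0 :=
  Finset.sum_eq_zero fun j hj => by
    rw [hx, edgeShape_zero_right (Finset.mem_Ioo.1 hj).1, mul_zero]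

/-- The value on the ray from `b 0` through the `l`-th point. -/
theorem edgeBubble_node {b : AffineBasis (Fin 3) ℝ Plane} {k : ℕ} {a : ℕ → ℝ} {l : ℕ}
    (hl : l ∈ Finset.Ioo 0 k) {x : Plane} {u : ℝ}
    (h1 : b.coord 1 x = u * (1 - (l : ℝ) / k)) (h2 : b.coord 2 x = u * ((l : ℝ) / k)) :
    edgeBubble b k a x = u ^ k * a l := by
  have hl' := Finset.mem_Ioo.1 hl
  unfold edgeBubble
  rw [Finset.sum_eq_single l]
  · rw [h1, h2, edgeShape_mul hl'.2.le, edgeShape_node (by omega) hl'.2.le]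
    simp [mul_comm]
  · intro j hj hjl
    rw [h1, h2, edgeShape_mul (Finset.mem_Ioo.1 hj).2.le, edgeShape_node (by omega) hl'.2.le,
      if_neg hjl.symm]
    simp
  · exact fun h => absurd hl h

/-- A barycentric coordinate stays in `[0, 1]` on the triangle, so it changes by at most one along a
radius of a disk contained in it. -/
theorem norm_coord_linear_le {b : AffineBasis (Fin 3) ℝ Plane} {z : Plane} {r : ℝ} (hr : 0 < r)
    (hb : Metric.closedBall z r ⊆ convexHull ℝ (Set.range b)) (i : Fin 3) :
    ‖(b.coord i).linear.toContinuousLinearMap‖ ≤ r⁻¹ := by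
  have h01 : ∀ x ∈ convexHull ℝ (Set.range b), 0 ≤ b.coord i x ∧ b.coord i x ≤ 1 := by
    intro x hx
    rw [b.convexHull_eq_nonneg_coord] at hx
    refine ⟨hx i, ?_⟩
    rw [← b.sum_coord_apply_eq_one x]
    exact Finset.single_le_sum (f := fun i => b.coord i x) (fun j _ => hx j) (Finset.mem_univ i)
  refine ContinuousLinearMap.opNorm_le_of_unit_norm (by positivity) fun v hv => ?_
  have h1 := h01 _ (hb (Metric.mem_closedBall_self hr.le))
  have h2 := h01 (r • v +ᵥ z) (hb (by simp [hv, norm_smul, abs_of_pos hr]))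
  rw [AffineMap.map_vadd, map_smul, vadd_eq_add, smul_eq_mul] at h2
  have h3 : |r * (b.coord i).linear v| ≤ 1 := abs_le.2 ⟨by linarith, by linarith⟩
  rw [abs_mul, abs_of_pos hr] at h3
  rw [LinearMap.coe_toContinuousLinearMap', Real.norm_eq_abs, inv_eq_one_div, le_div_iff₀ hr]
  linarith

/-- Chain rule: the barycentric coordinates map the triangle into the unit square, where the
derivative of the shape function is bounded, and their own derivatives are at most `r⁻¹`. -/
theorem exists_norm_gradient_edgeShape_le (k : ℕ) :
    ∃ C : ℝ, 0 < C ∧ ∀ j ∈ Finset.Ioo 0 k, ∀ (b : AffineBasis (Fin 3) ℝ Plane) (z : Plane) (r : ℝ),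
      0 < r → Metric.closedBall z r ⊆ convexHull ℝ (Set.range b) →
      ∀ x ∈ convexHull ℝ (Set.range b),
        ‖gradient (fun x => edgeShape k j (b.coord 1 x) (b.coord 2 x)) x‖ ≤ C / r := by
  have hB : ∀ j : ℕ, ∃ S : ℝ, ∀ y ∈ Set.Icc (0 : ℝ) 1 ×ˢ Set.Icc (0 : ℝ) 1,
      ‖fderiv ℝ (fun x : ℝ × ℝ => edgeShape k j x.1 x.2) y‖ ≤ S := by
    intro j
    obtain ⟨S, hS⟩ := (isCompact_Icc.prod isCompact_Icc).bddAbove_image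
      (K := Set.Icc (0 : ℝ) 1 ×ˢ Set.Icc (0 : ℝ) 1)
      (f := fun y => ‖fderiv ℝ (fun x : ℝ × ℝ => edgeShape k j x.1 x.2) y‖)
      (((contDiff_edgeShape k j).continuous_fderiv (by simp)).norm.continuousOn)
    exact ⟨S, fun y hy => hS ⟨y, hy, rfl⟩⟩
  choose S hS using hB
  refine ⟨1 + ∑ j ∈ Finset.Ioo 0 k, |S j|, by positivity, ?_⟩
  intro j hj b z r hr hb x hx
  have hSj : |S j| ≤ 1 + ∑ j ∈ Finset.Ioo 0 k, |S j| := by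
    have := Finset.single_le_sum (f := fun j => |S j|) (fun j _ => abs_nonneg _) hj
    linarith
  have hd : ∀ i, HasFDerivAt (b.coord i) (b.coord i).linear.toContinuousLinearMap x := by
    intro i
    rw [(b.coord i).decomp]
    exact (b.coord i).linear.toContinuousLinearMap.hasFDerivAt.add_const _
  have h1 := (((contDiff_edgeShape k j).differentiable (by simp)
    (b.coord 1 x, b.coord 2 x)).hasFDerivAt).comp x ((hd 1).prodMk (hd 2))
  have h2 : fderiv ℝ (fun x => edgeShape k j (b.coord 1 x) (b.coord 2 x)) x = _ := h1.fderiv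
  rw [norm_gradient, h2]
  refine (ContinuousLinearMap.opNorm_comp_le _ _).trans ?_
  rw [div_eq_mul_inv]
  rw [b.convexHull_eq_nonneg_coord] at hx
  have hmem : ∀ i, b.coord i x ∈ Set.Icc (0 : ℝ) 1 := by
    refine fun i => ⟨hx i, ?_⟩
    rw [← b.sum_coord_apply_eq_one x]
    exact Finset.single_le_sum (f := fun i => b.coord i x) (fun j _ => hx j) (Finset.mem_univ i)
  gcongr
  · exact ((hS j _ ⟨hmem 1, hmem 2⟩).trans (le_abs_self _)).trans hSj
  · refine ContinuousLinearMap.opNorm_le_bound _ (by positivity) fun v => ?_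
    have h : ∀ i, ‖(b.coord i).linear v‖ ≤ r⁻¹ * ‖v‖ := fun i =>
      ((b.coord i).linear.toContinuousLinearMap.le_opNorm v).trans
        (by gcongr; exact norm_coord_linear_le hr hb i)
    exact max_le (h 1) (h 2)

/-- The gradient of an edge bubble, whose values on the edge are bounded by the increments of a
polynomial `p` over distances small with respect to the triangle, is small with respect to the
gradient of `p`. -/
theorem exists_integral_gradient_edgeBubble_le (k : ℕ) (Γ D : ℝ) (hD : 0 ≤ D) :
    ∃ C : ℝ, 0 < C ∧ ∀ (b : AffineBasis (Fin 3) ℝ Plane) (z : Plane) (r : ℝ), 0 < r →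
      Metric.closedBall z r ⊆ convexHull ℝ (Set.range b) →
      Metric.diam (convexHull ℝ (Set.range b)) ≤ Γ * r →
      ∀ p : Plane → ℝ, IsPoly k p → ∀ η : ℝ, 0 ≤ η → η ≤ 1 → ∀ a : ℕ → ℝ,
      (∀ j ∈ Finset.Ioo 0 k, ∃ M ∈ convexHull ℝ (Set.range b), ∃ P,
        dist P M ≤ η * Metric.diam (convexHull ℝ (Set.range b)) ∧ |a j| ≤ D * |p P - p M|) →
      ∫ x in convexHull ℝ (Set.range b), ‖gradient (edgeBubble b k a) x‖ ^ 2 ≤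
        C * η ^ 2 * ∫ x in convexHull ℝ (Set.range b), ‖gradient p x‖ ^ 2 := by
  -- The points `P` may leave the triangle, but as `η ≤ 1` they stay within `2 h ≤ 2 Γ r` of the
  -- centre `z`.
  obtain ⟨C₁, hC₁, H₁⟩ := exists_norm_gradient_sq_le_integral k (2 * Γ)
  obtain ⟨C₂, hC₂, H₂⟩ := exists_norm_gradient_edgeShape_le k
  -- The factors come from the area, the number of shape functions with their increments and
  -- gradients, and the inverse inequality. The summand `1` makes the constant positive even if `Γ`
  -- or `D` vanishes.
  refine ⟨Real.pi * Γ ^ 2 * (k * (D * Γ * C₂)) ^ 2 * C₁ + 1, by positivity, ?_⟩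
  intro b z r hr hb hdiam p hp η hη hη1 a ha
  set T := convexHull ℝ (Set.range b) with hT
  set h := Metric.diam T with hh
  have hTc : IsCompact T := (Set.finite_range b).isCompact_convexHull (𝕜 := ℝ)
  have hzT : z ∈ T := hb (Metric.mem_closedBall_self hr.le)
  have hTb : T ⊆ Metric.closedBall z h := fun x hx =>
    Metric.dist_le_diam_of_mem hTc.isBounded hx hzT
  have hh0 : 0 ≤ h := Metric.diam_nonneg
  have hgc : ∀ q : Plane → ℝ, IsPoly k q → Continuous fun x => ‖gradient q x‖ ^ 2 := by
    intro q hq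
    simp only [norm_gradient]
    exact ((hq.contDiff.continuous_fderiv (by simp)).norm).pow 2
  have hint : ∀ q : Plane → ℝ, IsPoly k q → IntegrableOn (fun x => ‖gradient q x‖ ^ 2) T :=
    fun q hq => (hgc q hq).continuousOn.integrableOn_compact hTc
  set J := ∫ x in T, ‖gradient p x‖ ^ 2 with hJ
  have hJ0 : 0 ≤ J := integral_nonneg fun x => sq_nonneg _
  have hball : ∀ x ∈ Metric.closedBall z (2 * h), r ^ 2 * ‖gradient p x‖ ^ 2 ≤ C₁ * J := by
    intro x hx
    refine (H₁ p hp z r hr x ((Metric.mem_closedBall.1 hx).trans (by linarith))).trans ?_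
    gcongr
    exact setIntegral_mono_set (hint p hp) (Filter.Eventually.of_forall fun x => sq_nonneg _)
      (Filter.Eventually.of_forall hb)
  -- The bound for `grad p` on the large disk; the mean value inequality turns it into a bound for
  -- the increments.
  set G := Real.sqrt (C₁ * J) / r with hG
  have hG0 : 0 ≤ G := by positivity
  have hpG : ∀ x ∈ Metric.closedBall z (2 * h), ‖fderiv ℝ p x‖ ≤ G := by
    intro x hx
    rw [← norm_gradient, hG, le_div_iff₀ hr]
    refine Real.le_sqrt_of_sq_le ?_
    have := hball x hx
    nlinarith
  have haj : ∀ j ∈ Finset.Ioo 0 k, |a j| ≤ D * (G * (η * (Γ * r))) := by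
    intro j hj
    obtain ⟨M, hM, P, hPM, hle⟩ := ha j hj
    refine hle.trans ?_
    gcongr
    have hM' : M ∈ Metric.closedBall z (2 * h) := by
      have := hTb hM
      rw [Metric.mem_closedBall] at this ⊢
      linarith
    have hP' : P ∈ Metric.closedBall z (2 * h) := by
      have h1 := hTb hM
      rw [Metric.mem_closedBall] at h1 ⊢
      have : η * h ≤ h := by nlinarith
      linarith [dist_triangle P M z]
    refine ((convex_closedBall z (2 * h)).norm_image_sub_le_of_norm_fderiv_le
      (fun x _ => hp.differentiable x) hpG hM' hP').trans ?_
    rw [← dist_eq_norm]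
    gcongr
    exact hPM.trans (by gcongr)
  have hgr : ∀ x ∈ T, ‖gradient (edgeBubble b k a) x‖ ^ 2 ≤
      (k * (D * (G * (η * (Γ * r))) * (C₂ / r))) ^ 2 := by
    intro x hx
    have hd : ∀ j ∈ Finset.Ioo 0 k, DifferentiableAt ℝ
        (fun x => edgeShape k j (b.coord 1 x) (b.coord 2 x)) x := fun j hj =>
      (isPoly_edgeShape b (Finset.mem_Ioo.1 hj).2.le).differentiable x
    have e1 : fderiv ℝ (edgeBubble b k a) x = ∑ j ∈ Finset.Ioo 0 k,
        a j • fderiv ℝ (fun x => edgeShape k j (b.coord 1 x) (b.coord 2 x)) x := by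
      unfold edgeBubble
      rw [fderiv_fun_sum fun j hj => (hd j hj).const_mul _]
      exact Finset.sum_congr rfl fun j hj => fderiv_const_mul (hd j hj) _
    have hDG : 0 ≤ D * (G * (η * (Γ * r))) := by
      have : 0 ≤ Γ * r := hh0.trans hdiam
      positivity
    gcongr
    rw [norm_gradient, e1]
    refine (norm_sum_le _ _).trans ?_
    calc ∑ j ∈ Finset.Ioo 0 k,
          ‖a j • fderiv ℝ (fun x => edgeShape k j (b.coord 1 x) (b.coord 2 x)) x‖
        ≤ ∑ j ∈ Finset.Ioo 0 k, D * (G * (η * (Γ * r))) * (C₂ / r) := by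
          refine Finset.sum_le_sum fun j hj => ?_
          rw [norm_smul, Real.norm_eq_abs, ← norm_gradient]
          exact mul_le_mul (haj j hj) (H₂ j hj b z r hr hb x hx) (norm_nonneg _) hDG
      _ ≤ k * (D * (G * (η * (Γ * r))) * (C₂ / r)) := by
          rw [Finset.sum_const, nsmul_eq_mul]
          gcongr
          simp
  have hvol : (volume : Measure Plane).real T ≤ Real.pi * (Γ * r) ^ 2 := by
    calc (volume : Measure Plane).real T ≤ (volume : Measure Plane).real (Metric.closedBall z h) :=
          measureReal_mono hTb measure_closedBall_lt_top.ne
      _ = Real.pi * h ^ 2 := by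
          rw [Measure.real, EuclideanSpace.volume_closedBall_fin_two, ENNReal.toReal_mul,
            ENNReal.toReal_pow, ENNReal.toReal_ofReal hh0, mul_comm, ENNReal.toReal_ofReal Real.pi_pos.le]
      _ ≤ _ := by gcongr
  calc ∫ x in T, ‖gradient (edgeBubble b k a) x‖ ^ 2
      ≤ ∫ x in T, (k * (D * (G * (η * (Γ * r))) * (C₂ / r))) ^ 2 := by
        refine setIntegral_mono_on (hint _ (isPoly_edgeBubble b k a)) ?_ hTc.measurableSet hgr
        exact integrableOn_const hTc.measure_lt_top.ne
    _ = (volume : Measure Plane).real T * (k * (D * (G * (η * (Γ * r))) * (C₂ / r))) ^ 2 := by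
        simp
    _ ≤ (Real.pi * (Γ * r) ^ 2) * (k * (D * (G * (η * (Γ * r))) * (C₂ / r))) ^ 2 := by gcongr
    -- All powers of `r` cancel, which makes the constant independent of the size of the triangle.
    _ = (Real.pi * Γ ^ 2 * (k * (D * Γ * C₂)) ^ 2 * C₁) * η ^ 2 * J := by
        rw [hG]
        have : Real.sqrt (C₁ * J) ^ 2 = C₁ * J := Real.sq_sqrt (by positivity)
        field_simp
        rw [this]
        ring
    _ ≤ _ := by gcongr; linarith

end EdgeBubbles

/-! ### Local flatness of the boundary and existence of the nodes -/

section Boundary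

open Metric

/-- Near a boundary point, the boundary is the zero set of a function with an almost constant unit
gradient. -/
theorem IsCkDomain.exists_nhds_flat {k : ℕ} (hk : 2 ≤ k) {Ω : Set Plane} (hΩ : IsCkDomain k Ω)
    {ε : ℝ} (hε : 0 < ε) {x : Plane} (hx : x ∈ frontier Ω) :
    ∃ U : Set Plane, IsOpen U ∧ x ∈ U ∧ ∃ (n : Plane) (F : Plane → ℝ), ‖n‖ = 1 ∧
      (∀ y ∈ U, ∀ z ∈ U, |F y - F z - inner ℝ n (y - z)| ≤ ε * ‖y - z‖) ∧
      ∀ y ∈ U, y ∈ frontier Ω ↔ F y = 0 := by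
  obtain ⟨e, φ, hφ, hloc⟩ := hΩ.boundary x hx
  let F₀ : Plane → ℝ := fun y => e y 1 - φ (e y 0)
  have hφ1 : ContDiff ℝ 1 φ := hφ.of_le (by exact_mod_cast (by omega : 1 ≤ k))
  have hF₀ : ContDiff ℝ 1 F₀ := by
    have he : ContDiff ℝ 1 e := e.toAffineIsometry.toContinuousAffineMap.contDiff
    have h : ∀ i, ContDiff ℝ 1 fun y => e y i := fun i =>
      (EuclideanSpace.proj (𝕜 := ℝ) i).contDiff.comp he
    exact (h 1).sub (hφ1.comp (h 0))
  -- In the graph direction `F₀` grows with slope exactly one. This shows that its derivative is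
  -- nonzero and that zeros of `F₀` are limits of points of `Ω`.
  let up : Plane := e.linearIsometryEquiv.symm (EuclideanSpace.single 1 1)
  have hup : ∀ y (t : ℝ), F₀ (y + t • up) = F₀ y + t := by
    intro y t
    have h1 : e (y + t • up) = t • EuclideanSpace.single 1 (1 : ℝ) + e y := by
      rw [add_comm, ← vadd_eq_add, e.map_vadd]
      simp [up]
    simp only [F₀, h1]
    simp
    ring
  have hd := (hF₀.contDiffAt (x := x)).hasStrictFDerivAt (by simp)
  set L := fderiv ℝ F₀ x with hL
  have hLup : L up = 1 := by
    have h1 : HasDerivAt (fun t : ℝ => F₀ (x + t • up)) (L up) 0 := by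
      have h2 : HasDerivAt (fun t : ℝ => x + t • up) up 0 := by
        simpa using ((hasDerivAt_id (0 : ℝ)).smul_const up).const_add x
      have h3 : HasFDerivAt F₀ L (x + (0 : ℝ) • up) := by simpa using hd.hasFDerivAt
      exact h3.comp_hasDerivAt 0 h2
    have h4 : HasDerivAt (fun t : ℝ => F₀ (x + t • up)) 1 0 := by
      simp only [hup]
      simpa using (hasDerivAt_id (0 : ℝ)).const_add (F₀ x)
    exact h1.unique h4
  have hLpos : 0 < ‖L‖ := by
    rw [norm_pos_iff]
    intro h
    simp [h] at hLup
  -- Strict differentiability is what compares two arbitrary nearby points. The factor `‖L‖`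
  -- disappears when the gradient is normalized.
  have hapx : ∀ᶠ q in 𝓝 x ×ˢ 𝓝 x, ‖F₀ q.1 - F₀ q.2 - L (q.1 - q.2)‖ ≤
      (ε * ‖L‖) * ‖q.1 - q.2‖ := by
    rw [← nhds_prod_eq]
    exact (Asymptotics.isLittleO_iff.1 hd.isLittleO) (by positivity)
  obtain ⟨t, ht, hapx⟩ := Filter.eventually_prod_self_iff
    (r := fun y z => ‖F₀ y - F₀ z - L (y - z)‖ ≤ (ε * ‖L‖) * ‖y - z‖) |>.1 hapx
  obtain ⟨U₁, hU₁, hU₁o, hxU₁⟩ := _root_.mem_nhds_iff.1 ht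
  obtain ⟨U₂, hU₂, hU₂o, hxU₂⟩ := _root_.mem_nhds_iff.1 hloc
  have hfr : ∀ y ∈ U₂, y ∈ frontier Ω ↔ F₀ y = 0 := by
    intro y hy
    have hmem : ∀ z ∈ U₂, z ∈ Ω ↔ 0 < F₀ z := fun z hz => by
      simpa [F₀] using (hU₂ hz : z ∈ Ω ↔ _)
    have hU₂n := hU₂o.mem_nhds hy
    rw [frontier, Set.mem_sdiff, hΩ.isOpen.interior_eq]
    constructor
    · rintro ⟨hcl, hnot⟩
      refine le_antisymm (not_lt.1 fun h => hnot ((hmem y hy).2 h)) ?_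
      by_contra! hlt
      have : ∀ᶠ z in 𝓝 y, F₀ z < 0 ∧ z ∈ U₂ :=
        ((hF₀.continuous.continuousAt.eventually_lt_const hlt)).and hU₂n
      obtain ⟨z, hzΩ, hz⟩ := (mem_closure_iff_frequently.1 hcl |>.and_eventually this).exists
      exact absurd ((hmem z hz.2).1 hzΩ) (by linarith [hz.1])
    · intro h0
      refine ⟨?_, fun h => by have := (hmem y hy).1 h; linarith⟩
      have hlim : Filter.Tendsto (fun t : ℝ => y + t • up) (𝓝[>] 0) (𝓝 y) := by
        have : ContinuousAt (fun t : ℝ => y + t • up) 0 := by fun_prop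
        simpa using this.tendsto.mono_left nhdsWithin_le_nhds
      refine mem_closure_of_tendsto hlim ?_
      filter_upwards [hlim hU₂n, self_mem_nhdsWithin] with t h1 h2
      refine (hmem _ h1).2 ?_
      rw [hup, h0, zero_add]
      exact h2
  refine ⟨U₁ ∩ U₂, hU₁o.inter hU₂o, ⟨hxU₁, hxU₂⟩,
    ‖L‖⁻¹ • (InnerProductSpace.toDual ℝ Plane).symm L, fun y => ‖L‖⁻¹ * F₀ y, ?_, ?_, ?_⟩
  · simp [norm_smul, hLpos.ne']
  · intro y hy z hz
    have h := hapx y (hU₁ hy.1) z (hU₁ hz.1)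
    rw [Real.norm_eq_abs] at h
    rw [real_inner_smul_left, InnerProductSpace.toDual_symm_apply, ← mul_sub, ← mul_sub, abs_mul,
      abs_of_pos (inv_pos.2 hLpos), inv_mul_le_iff₀ hLpos]
    linarith
  · intro y hy
    rw [hfr y hy.2]
    simp [hLpos.ne']

/-- The boundary is compact, so a Lebesgue number of the local neighbourhoods gives one radius for
all its points. This is why the final threshold on `h` does not depend on the mesh. -/
theorem IsCkDomain.exists_flat {k : ℕ} (hk : 2 ≤ k) {Ω : Set Plane} (hΩ : IsCkDomain k Ω)
    {ε : ℝ} (hε : 0 < ε) :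
    ∃ δ > 0, ∀ x ∈ frontier Ω, ∃ (n : Plane) (F : Plane → ℝ), ‖n‖ = 1 ∧
      (∀ y ∈ ball x δ, ∀ z ∈ ball x δ, |F y - F z - inner ℝ n (y - z)| ≤ ε * ‖y - z‖) ∧
      ∀ y ∈ ball x δ, y ∈ frontier Ω ↔ F y = 0 := by
  have hc : IsCompact (frontier Ω) :=
    hΩ.isBounded.isCompact_closure.of_isClosed_subset isClosed_frontier frontier_subset_closure
  choose! U hUo hxU h using fun x hx => hΩ.exists_nhds_flat hk hε (x := x) hx
  obtain ⟨δ, hδ, H⟩ := lebesgue_number_lemma_of_metric hc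
    (c := fun x : frontier Ω => U x) (fun x => hUo x x.2)
    (fun x hx => Set.mem_iUnion.2 ⟨⟨x, hx⟩, hxU x hx⟩)
  refine ⟨δ, hδ, fun x hx => ?_⟩
  obtain ⟨i, hi⟩ := H x hx
  obtain ⟨n, F, hn, h1, h2⟩ := h i i.2
  exact ⟨n, F, hn, fun y hy z hz => h1 y (hi hy) z (hi hz), fun y hy => h2 y (hi hy)⟩

/-- A real function with an almost constant derivative of absolute value at least `r` has exactly
one zero in the unit interval around a point where it is small. -/
theorem exists_unique_zero {g : ℝ → ℝ} {m r σ : ℝ} (hr : 0 < r) (hm : r ≤ |m|) (hσ : σ ≤ 1)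
    (hσ0 : 0 ≤ σ) (hg : ∀ s ∈ Set.Icc (-1 : ℝ) 1, ∀ t ∈ Set.Icc (-1 : ℝ) 1,
      |g s - g t - (s - t) * m| ≤ r / 2 * |s - t|)
    (h0 : |g 0| ≤ σ * (r / 2)) :
    ∃ τ, |τ| ≤ σ ∧ g τ = 0 ∧ ∀ t, |t| ≤ 1 → g t = 0 → t = τ := by
  -- Replacing `g` and `m` by their negatives makes the function increasing.
  wlog hm0 : 0 ≤ m generalizing g m
  · obtain ⟨τ, h1, h2, h3⟩ := this (g := fun t => -g t) (m := -m) (by rwa [abs_neg])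
      (fun s hs t ht => by
        rw [← abs_neg]
        convert hg s hs t ht using 2
        ring) (by simpa using h0) (by linarith)
    exact ⟨τ, h1, by simpa using h2, fun t ht h => h3 t ht (by simpa using h)⟩
  rw [abs_of_nonneg hm0] at hm
  have hcont : ContinuousOn g (Set.Icc (-1) 1) := by
    have : LipschitzOnWith (Real.toNNReal (r / 2 + m)) g (Set.Icc (-1) 1) := by
      refine LipschitzOnWith.of_dist_le_mul fun s hs t ht => ?_
      rw [Real.coe_toNNReal _ (by positivity), Real.dist_eq, Real.dist_eq]
      have h1 := hg s hs t ht
      calc |g s - g t| = |(g s - g t - (s - t) * m) + (s - t) * m| := by ring_nf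
        _ ≤ |g s - g t - (s - t) * m| + |(s - t) * m| := abs_add_le _ _
        _ ≤ r / 2 * |s - t| + |s - t| * m := by rw [abs_mul, abs_of_nonneg hm0]; gcongr
        _ = _ := by ring
    exact this.continuousOn
  have hσI : Set.Icc (-σ) σ ⊆ Set.Icc (-1) 1 := Set.Icc_subset_Icc (by linarith) hσ
  have hz : (0 : ℝ) ∈ Set.Icc (-1 : ℝ) 1 := by simp
  -- The slopes of `g` are at least `m - r / 2 ≥ r / 2`, so over a length `σ` it makes up for the
  -- value at zero. The same slope bound gives uniqueness below.
  have hhi : 0 ≤ g σ := by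
    have h1 := hg σ (hσI ⟨by linarith, le_rfl⟩) 0 hz
    rw [sub_zero, abs_of_nonneg hσ0] at h1
    have := (abs_le.1 h1).1
    have := (abs_le.1 h0).1
    nlinarith
  have hlo : g (-σ) ≤ 0 := by
    have h1 := hg (-σ) (hσI ⟨le_rfl, by linarith⟩) 0 hz
    rw [sub_zero, abs_neg, abs_of_nonneg hσ0] at h1
    have := (abs_le.1 h1).2
    have := (abs_le.1 h0).2
    nlinarith
  obtain ⟨τ, hτ, hτ0⟩ := intermediate_value_Icc (by linarith : -σ ≤ σ) (hcont.mono hσI)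
    ⟨hlo, hhi⟩
  refine ⟨τ, abs_le.2 hτ, hτ0, fun t ht ht0 => ?_⟩
  have h1 := hg t (abs_le.1 ht) τ (hσI hτ)
  rw [ht0, hτ0, sub_zero, zero_sub, abs_neg, abs_mul, abs_of_nonneg hm0] at h1
  by_contra hne
  have : 0 < |t - τ| := abs_pos.2 (sub_ne_zero.2 hne)
  nlinarith

/-- Otherwise the three vertices, hence the triangle, would lie in a strip about `M` of half-width
less than `r` with normal `n`, and the points `z ± r n` of the disk do not fit into it. -/
theorem le_abs_inner_of_closedBall_subset {O A B M z n : Plane} {r μ : ℝ} (hr : 0 < r)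
    (hn : ‖n‖ = 1) (hb : closedBall z r ⊆ convexHull ℝ {O, A, B}) (hμ : μ < r)
    (hA : |inner ℝ n (A - M)| ≤ μ) (hB : |inner ℝ n (B - M)| ≤ μ) :
    r ≤ |inner ℝ n (M - O)| := by
  by_contra! hO
  set R := max |inner ℝ n (M - O)| μ with hR
  have hRr : R < r := max_lt hO hμ
  have hconv : Convex ℝ {x : Plane | |inner ℝ n (x - M)| ≤ R} := by
    have : {x : Plane | |inner ℝ n (x - M)| ≤ R} =
        (innerSL ℝ n) ⁻¹' Metric.closedBall (inner ℝ n M) R := by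
      ext x
      simp [Real.dist_eq, inner_sub_right]
    rw [this]
    exact (convex_closedBall _ _).is_linear_preimage (innerSL ℝ n).toLinearMap.isLinear
  have hsub : convexHull ℝ {O, A, B} ⊆ {x : Plane | |inner ℝ n (x - M)| ≤ R} := by
    refine convexHull_min ?_ hconv
    rintro x (rfl | rfl | rfl)
    · simp only [Set.mem_ofPred_eq]
      rw [← neg_sub M x, inner_neg_right, abs_neg]
      exact le_max_left _ _
    · exact hA.trans (le_max_right _ _)
    · exact hB.trans (le_max_right _ _)
  have h1 : |inner ℝ n (z + r • n - M)| ≤ R :=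
    hsub (hb (by simp [norm_smul, hn, abs_of_pos hr]))
  have h2 : |inner ℝ n (z - r • n - M)| ≤ R :=
    hsub (hb (by simp [norm_smul, hn, abs_of_pos hr]))
  have hnn : inner ℝ n n = (1 : ℝ) := by rw [real_inner_self_eq_norm_sq, hn]; norm_num
  simp only [inner_sub_right, inner_add_right, real_inner_smul_right, hnn] at h1 h2
  have := abs_le.1 h1
  have := abs_le.1 h2
  linarith

/-- For a small shape-regular triangle with an edge joining two points of the boundary, the line
from the opposite vertex through a point `M` of the edge has a unique nearest intersection with
the boundary, and its distance from `M` is small with respect to the triangle. -/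
theorem IsCkDomain.exists_nearestIntersection {k : ℕ} (hk : 2 ≤ k) {Ω : Set Plane}
    (hΩ : IsCkDomain k Ω) (Γ : ℝ) {η : ℝ} (hη : 0 < η) :
    ∃ h₀ > 0, ∀ (O A B z : Plane) (r : ℝ), 0 < r → closedBall z r ⊆ convexHull ℝ {O, A, B} →
      diam (convexHull ℝ {O, A, B}) ≤ Γ * r → diam (convexHull ℝ {O, A, B}) ≤ h₀ →
      A ∈ frontier Ω → B ∈ frontier Ω → ∀ s ∈ Set.Icc (0 : ℝ) 1, ∃ τ : ℝ, |τ| ≤ η ∧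
        ∀ P, IsNearestIntersection Ω O (AffineMap.lineMap A B s) P ↔
          P = AffineMap.lineMap A B s + τ • (AffineMap.lineMap A B s - O) := by
  -- Chosen so that `ε h ≤ ε Γ r ≤ min η 1 · r / 4`. The minimum with `1` keeps the parameter `τ` in
  -- the range where the flatness estimate applies.
  set ε := min η 1 / (4 * (|Γ| + 1)) with hε
  have hε0 : 0 < ε := by positivity
  have hεΓ : ε * |Γ| ≤ min η 1 / 4 := by
    rw [hε, div_mul_eq_mul_div, div_le_div_iff₀ (by positivity) (by norm_num)]
    nlinarith [abs_nonneg Γ, lt_min hη one_pos]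
  obtain ⟨δ, hδ, hflat⟩ := hΩ.exists_flat hk hε0
  -- For `|τ| ≤ 1` the points `M + τ (M - O)` are within `2 h < δ` of `A`.
  refine ⟨δ / 3, by positivity, ?_⟩
  intro O A B z r hr hb hΓ hδ' hA hB s hs
  set T := convexHull ℝ {O, A, B} with hT
  set h := diam T with hh
  set M : Plane := AffineMap.lineMap A B s with hM
  have hbd : Bornology.IsBounded T := ((Set.toFinite _).isCompact_convexHull (𝕜 := ℝ)).isBounded
  have hOT : O ∈ T := subset_convexHull ℝ _ (by simp)
  have hAT : A ∈ T := subset_convexHull ℝ _ (by simp)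
  have hBT : B ∈ T := subset_convexHull ℝ _ (by simp)
  have hMT : M ∈ T := (convex_convexHull ℝ _).lineMap_mem hAT hBT hs
  have hdist : ∀ x ∈ T, ∀ y ∈ T, ‖x - y‖ ≤ h := fun x hx y hy => by
    rw [← dist_eq_norm]; exact dist_le_diam_of_mem hbd hx hy
  have hh0 : 0 ≤ h := diam_nonneg
  have hεh : ε * h ≤ min η 1 / 4 * r := by
    calc ε * h ≤ ε * (|Γ| * r) := by
          gcongr; exact hΓ.trans (by gcongr; exact le_abs_self _)
      _ = ε * |Γ| * r := by ring
      _ ≤ _ := by gcongr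
  have hεh4 : ε * h ≤ r / 4 := hεh.trans (by nlinarith [min_le_right η 1])
  obtain ⟨n, F, hn, hF, hFr⟩ := hflat A hA
  have hTball : ∀ x ∈ T, x ∈ ball A δ := fun x hx => by
    rw [mem_ball, dist_eq_norm]; linarith [hdist x hx A hAT]
  have hFA : F A = 0 := (hFr A (hTball A hAT)).1 hA
  have hFB : F B = 0 := (hFr B (hTball B hBT)).1 hB
  -- `F` vanishes at both ends of the edge, so the edge is almost orthogonal to `n`; by shape
  -- regularity the line through `O` and `M` is then transversal to the boundary.
  have hAB : |inner ℝ n (B - A)| ≤ ε * h := by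
    have := hF B (hTball B hBT) A (hTball A hAT)
    rw [hFA, hFB, sub_zero, zero_sub, abs_neg] at this
    exact this.trans (by gcongr; exact hdist B hBT A hAT)
  have hMA : M - A = s • (B - A) := by simp [hM, AffineMap.lineMap_apply]
  have hMB : B - M = (1 - s) • (B - A) := by
    rw [← sub_sub_sub_cancel_right B M A, hMA]; module
  have h1 : |inner ℝ n (A - M)| ≤ ε * h := by
    rw [← neg_sub M A, hMA, inner_neg_right, abs_neg, real_inner_smul_right, abs_mul,
      abs_of_nonneg hs.1]
    nlinarith [abs_nonneg (inner ℝ n (B - A)), hs.2, hs.1]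
  have h2 : |inner ℝ n (B - M)| ≤ ε * h := by
    rw [hMB, real_inner_smul_right, abs_mul, abs_of_nonneg (by linarith [hs.2])]
    nlinarith [abs_nonneg (inner ℝ n (B - A)), hs.2, hs.1]
  have hnd : r ≤ |inner ℝ n (M - O)| :=
    le_abs_inner_of_closedBall_subset hr hn hb (by linarith) h1 h2
  have hd0 : 0 < ‖M - O‖ := by
    rw [norm_pos_iff]
    intro h0
    rw [h0, inner_zero_right, abs_zero] at hnd
    linarith
  have hline : ∀ τ ∈ Set.Icc (-1 : ℝ) 1, M + τ • (M - O) ∈ ball A δ := by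
    intro τ hτ
    rw [mem_ball, dist_eq_norm, add_sub_right_comm]
    have : ‖τ • (M - O)‖ ≤ h := by
      rw [norm_smul, Real.norm_eq_abs]
      have := abs_le.2 hτ
      nlinarith [hdist M hMT O hOT, norm_nonneg (M - O), abs_nonneg τ]
    linarith [norm_add_le (M - A) (τ • (M - O)), hdist M hMT A hAT]
  obtain ⟨τ, hτ, hτ0, huniq⟩ := exists_unique_zero (g := fun τ => F (M + τ • (M - O)))
    (m := inner ℝ n (M - O)) (r := r) (σ := min η 1) hr hnd (min_le_right _ _) (by positivity)
    (by
      intro s hs t ht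
      have := hF _ (hline s hs) _ (hline t ht)
      rw [add_sub_add_left_eq_sub, ← sub_smul, real_inner_smul_right, norm_smul,
        Real.norm_eq_abs] at this
      refine this.trans ?_
      calc ε * (|s - t| * ‖M - O‖) ≤ ε * (|s - t| * h) := by gcongr; exact hdist M hMT O hOT
        _ = (ε * h) * |s - t| := by ring
        _ ≤ _ := by gcongr; linarith)
    (by
      have := hF M (hTball M hMT) A (hTball A hAT)
      rw [hFA, sub_zero, ← neg_sub A M, inner_neg_right, sub_neg_eq_add, norm_neg] at this
      have h3 : ε * ‖A - M‖ ≤ ε * h := by gcongr; exact hdist A hAT M hMT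
      simp only [zero_smul, add_zero]
      have := abs_le.1 this
      have := abs_le.1 h1
      rw [abs_le]
      constructor <;> linarith)
  refine ⟨τ, hτ.trans (min_le_left _ _), ?_⟩
  have hτ1 : |τ| ≤ 1 := hτ.trans (min_le_right _ _)
  have hmem : M + τ • (M - O) ∈ frontier Ω := (hFr _ (hline τ (abs_le.1 hτ1))).2 hτ0
  have hdM : ∀ t : ℝ, dist M (M + t • (M - O)) = |t| * ‖M - O‖ := by
    intro t; rw [dist_self_add_right, norm_smul, Real.norm_eq_abs]
  have hon : ∀ Q ∈ line[ℝ, O, M], ∃ t : ℝ, Q = M + t • (M - O) := by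
    intro Q hQ
    obtain ⟨t, rfl⟩ := (mem_affineSpan_pair_iff_exists_lineMap_eq).1 hQ
    refine ⟨t - 1, ?_⟩
    rw [AffineMap.lineMap_apply, vsub_eq_sub, vadd_eq_add]
    module
  -- A boundary point of the line no farther from `M` than the zero found also has parameter at most
  -- one in absolute value, where that zero is the only one.
  have hclose : ∀ Q ∈ frontier Ω, Q ∈ line[ℝ, O, M] →
      dist M Q ≤ dist M (M + τ • (M - O)) → Q = M + τ • (M - O) := by
    intro Q hQ hQl hle
    obtain ⟨t, rfl⟩ := hon Q hQl
    rw [hdM, hdM, mul_le_mul_iff_left₀ hd0] at hle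
    have ht1 := hle.trans hτ1
    rw [huniq t ht1 ((hFr _ (hline t (abs_le.1 ht1))).1 hQ)]
  have hPl : M + τ • (M - O) ∈ line[ℝ, O, M] := by
    refine (mem_affineSpan_pair_iff_exists_lineMap_eq).2 ⟨τ + 1, ?_⟩
    rw [AffineMap.lineMap_apply, vsub_eq_sub, vadd_eq_add]
    module
  intro P
  constructor
  · rintro ⟨hP, hPl', hmin⟩
    exact hclose P hP hPl' (hmin _ hmem hPl)
  · rintro rfl
    refine ⟨hmem, hPl, fun Q hQ hQl => ?_⟩
    by_contra! hlt
    rw [hclose Q hQ hQl hlt.le] at hlt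
    exact lt_irrefl _ hlt

end Boundary

/-! ### Incidence of triangles, boundary edges and gluing -/

section MeshTopology

theorem affineMap_eq_sum_coord (b : AffineBasis (Fin 3) ℝ Plane) (f : Plane →ᵃ[ℝ] ℝ) (x : Plane) :
    f x = ∑ i, b.coord i x * f (b i) := by
  have h := congrArg f (b.affineCombination_coord_eq_self x)
  rw [Finset.map_affineCombination _ _ _ (b.sum_coord_apply_eq_one x),
    Finset.affineCombination_eq_linear_combination _ _ _ (b.sum_coord_apply_eq_one x)] at h
  rw [← h]
  simp

theorem coord_lineMap (b : AffineBasis (Fin 3) ℝ Plane) (i : Fin 3) (x y : Plane) (t : ℝ) :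
    b.coord i (AffineMap.lineMap x y t) = (1 - t) * b.coord i x + t * b.coord i y := by
  rw [AffineMap.apply_lineMap, AffineMap.lineMap_apply_ring]

variable {K : Geometry.SimplicialComplex ℝ Plane} {T T' : Finset Plane}
  {b b' : AffineBasis (Fin 3) ℝ Plane}

theorem exists_affineBasis (hT : T ∈ triangles K) {O A B : Plane} (h : T = {O, A, B}) :
    ∃ b : AffineBasis (Fin 3) ℝ Plane, b 0 = O ∧ b 1 = A ∧ b 2 = B ∧ Set.range b = T := by
  have hinj : Function.Injective ![O, A, B] := by
    have hOA : O ≠ A := by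
      rintro rfl
      have := hT.2
      rw [h] at this
      have := Finset.card_le_two (a := O) (b := B)
      simp_all
    have hOB : O ≠ B := by
      rintro rfl
      have := hT.2
      rw [h] at this
      have := Finset.card_le_two (a := O) (b := A)
      simp_all [Finset.pair_comm]
    have hAB : A ≠ B := by
      rintro rfl
      have := hT.2
      rw [h] at this
      have := Finset.card_le_two (a := O) (b := A)
      simp_all
    intro i j hij
    fin_cases i <;> fin_cases j <;> simp_all
  have hr : Set.range ![O, A, B] = (T : Set Plane) := by
    rw [h]; ext x; simp [eq_comm]; tauto
  have hi : AffineIndependent ℝ ![O, A, B] := by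
    have h1 := K.indep hT.1
    let f : Fin 3 ↪ T := ⟨fun i => ⟨![O, A, B] i, by
      have : ![O, A, B] i ∈ (T : Set Plane) := hr ▸ Set.mem_range_self i
      exact this⟩, fun i j hij => hinj (by simpa using hij)⟩
    exact h1.comp_embedding f
  have ht : affineSpan ℝ (Set.range ![O, A, B]) = ⊤ := by
    rw [hi.affineSpan_eq_top_iff_card_eq_finrank_add_one]; simp
  exact ⟨⟨_, hi, ht⟩, rfl, rfl, rfl, hr⟩

theorem exists_affineBasis' (hT : T ∈ triangles K) :
    ∃ b : AffineBasis (Fin 3) ℝ Plane, Set.range b = T := by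
  obtain ⟨O, A, B, -, -, -, h⟩ := Finset.card_eq_three.1 hT.2
  obtain ⟨b, -, -, -, hb⟩ := exists_affineBasis hT h
  exact ⟨b, hb⟩

theorem mem_hull_iff (hb : Set.range b = T) {x : Plane} : x ∈ hull T ↔ ∀ i, 0 ≤ b.coord i x := by
  rw [hull, ← hb, b.convexHull_eq_nonneg_coord]; rfl

theorem mem_interior_hull_iff (hb : Set.range b = T) {x : Plane} :
    x ∈ interior (hull T) ↔ ∀ i, 0 < b.coord i x := by
  rw [hull, ← hb, b.interior_convexHull]; rfl

theorem isCompact_hull (T : Finset Plane) : IsCompact (hull T) :=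
  T.finite_toSet.isCompact_convexHull (𝕜 := ℝ)

/-- The triangles meet in the hull of their common vertices, on which the barycentric coordinate of
any other vertex of `T` is zero. -/
theorem mem_of_coord_pos (hT : T ∈ triangles K) (hT' : T' ∈ triangles K) (hb : Set.range b = T)
    {x : Plane} (hx : x ∈ hull T) (hx' : x ∈ hull T') {i : Fin 3} (hi : 0 < b.coord i x) :
    b i ∈ T' := by
  by_contra hbi
  have h1 := K.inter_subset_convexHull hT.1 hT'.1 ⟨hx, hx'⟩
  have h2 : convexHull ℝ ((T : Set Plane) ∩ T') ⊆ {y | b.coord i y = 0} := by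
    refine convexHull_min ?_ ((convex_singleton (0 : ℝ)).affine_preimage (b.coord i))
    rintro y ⟨hy, hy'⟩
    rw [← hb] at hy
    obtain ⟨j, rfl⟩ := hy
    refine b.coord_apply_ne ?_
    rintro rfl
    exact hbi hy'
  have h3 : b.coord i x = 0 := h2 h1
  linarith

theorem eq_of_mem_interior (hT : T ∈ triangles K) (hT' : T' ∈ triangles K)
    {x : Plane} (hx : x ∈ interior (hull T)) (hx' : x ∈ hull T') : T = T' := by
  obtain ⟨b, hb⟩ := exists_affineBasis' hT
  refine Finset.eq_of_subset_of_card_le (fun y hy => ?_) (by rw [hT.2, hT'.2])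
  have hy' : y ∈ Set.range b := by rw [hb]; exact hy
  obtain ⟨i, rfl⟩ := hy'
  exact mem_of_coord_pos hT hT' hb (interior_subset hx) hx' ((mem_interior_hull_iff hb).1 hx i)

theorem hull_subset_space (hT : T ∈ triangles K) : hull T ⊆ K.space :=
  K.convexHull_subset_space hT.1

/-- The relative interior of a common edge of two triangles lies in the interior of the mesh. -/
theorem mem_interior_space (hT : T ∈ triangles K) (hT' : T' ∈ triangles K) (hne : T ≠ T')
    (hb : Set.range b = T) (h1 : b 1 ∈ T') (h2 : b 2 ∈ T') {y : Plane} (hy0 : b.coord 0 y = 0)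
    (hy1 : 0 < b.coord 1 y) (hy2 : 0 < b.coord 2 y) : y ∈ interior K.space := by
  classical
  have h12 : b 1 ≠ b 2 := fun h => by simpa using b.ind.injective h
  obtain ⟨O, hO⟩ : ∃ O, T' = {O, b 1, b 2} := by
    have hc : (T' \ {b 1, b 2}).card = 1 := by
      rw [Finset.card_sdiff_of_subset (by simp [Finset.insert_subset_iff, h1, h2]), hT'.2,
        Finset.card_pair h12]
    obtain ⟨O, hO⟩ := Finset.card_eq_one.1 hc
    refine ⟨O, ?_⟩
    rw [Finset.insert_eq, ← hO, Finset.sdiff_union_of_subset]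
    simp [Finset.insert_subset_iff, h1, h2]
  obtain ⟨b', b0, b1, b2, hb'⟩ := exists_affineBasis hT' hO
  -- The coordinates opposite to the common edge are proportional. The sign of the factor tells on
  -- which side of the edge the two apexes lie.
  have e0 : ∀ z, b'.coord 0 z = b.coord 0 z * b'.coord 0 (b 0) := by
    intro z
    rw [affineMap_eq_sum_coord b (b'.coord 0), Fin.sum_univ_three, ← b1, ← b2,
      b'.coord_apply_ne (by decide), b'.coord_apply_ne (by decide)]
    ring
  have e1 : ∀ z, b'.coord 1 z = b.coord 0 z * b'.coord 1 (b 0) + b.coord 1 z := by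
    intro z
    rw [affineMap_eq_sum_coord b (b'.coord 1), Fin.sum_univ_three, ← b1, ← b2,
      b'.coord_apply_eq, b'.coord_apply_ne (by decide)]
    ring
  have e2 : ∀ z, b'.coord 2 z = b.coord 0 z * b'.coord 2 (b 0) + b.coord 2 z := by
    intro z
    rw [affineMap_eq_sum_coord b (b'.coord 2), Fin.sum_univ_three, ← b1, ← b2,
      b'.coord_apply_eq, b'.coord_apply_ne (by decide)]
    ring
  have hc : ∀ (b : AffineBasis (Fin 3) ℝ Plane) i, 0 < b.coord i y → ∀ᶠ z in 𝓝 y, 0 < b.coord i z :=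
    fun b i h => (continuous_barycentric_coord b i).continuousAt.eventually_const_lt h
  have hev : ∀ᶠ z in 𝓝 y, (0 < b.coord 1 z ∧ 0 < b.coord 2 z) ∧
      0 < b'.coord 1 z ∧ 0 < b'.coord 2 z :=
    ((hc b 1 hy1).and (hc b 2 hy2)).and
      ((hc b' 1 (by rw [e1, hy0]; linarith)).and (hc b' 2 (by rw [e2, hy0]; linarith)))
  -- Apexes on the same side would make the triangles overlap near `y`, hence coincide. Otherwise
  -- the two triangles together cover a neighbourhood of `y`.
  rcases lt_or_ge 0 (b'.coord 0 (b 0)) with hpos | hneg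
  · exfalso
    have hlim : Filter.Tendsto (fun t : ℝ => AffineMap.lineMap y (b 0) t) (𝓝[>] 0) (𝓝 y) := by
      have : ContinuousAt (fun t : ℝ => AffineMap.lineMap y (b 0) t) 0 :=
        AffineMap.lineMap_continuous.continuousAt
      have h := this.tendsto.mono_left (nhdsWithin_le_nhds (s := Set.Ioi 0))
      simpa using h
    obtain ⟨t, ht, ht0⟩ := ((hlim.eventually hev).and self_mem_nhdsWithin).exists
    have hz : b.coord 0 (AffineMap.lineMap y (b 0) t) = t := by
      rw [coord_lineMap, hy0, b.coord_apply_eq]; ring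
    have ht0' : 0 < t := ht0
    refine hne (eq_of_mem_interior hT hT' (x := AffineMap.lineMap y (b 0) t) ?_ ?_)
    · rw [mem_interior_hull_iff hb]
      intro i
      fin_cases i
      · simpa [hz] using ht0
      · exact ht.1.1
      · exact ht.1.2
    · rw [mem_hull_iff hb']
      intro i
      fin_cases i
      · change 0 ≤ b'.coord 0 _
        rw [e0, hz]; positivity
      · exact ht.2.1.le
      · exact ht.2.2.le
  · rw [mem_interior_iff_mem_nhds]
    filter_upwards [hev] with z hz
    rcases le_or_gt 0 (b.coord 0 z) with h0 | h0
    · refine hull_subset_space hT ((mem_hull_iff hb).2 fun i => ?_)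
      fin_cases i
      · exact h0
      · exact hz.1.1.le
      · exact hz.1.2.le
    · refine hull_subset_space hT' ((mem_hull_iff hb').2 fun i => ?_)
      fin_cases i
      · change 0 ≤ b'.coord 0 _
        rw [e0]; nlinarith
      · exact hz.2.1.le
      · exact hz.2.2.le

theorem hull_pair (A B : Plane) : hull {A, B} = segment ℝ A B := by
  rw [hull, Finset.coe_pair, convexHull_pair]

theorem pair_notMem_boundaryEdges (hT : T ∈ triangles K) (hT' : T' ∈ triangles K) (hne : T ≠ T')
    (hb : Set.range b = T) (h1 : b 1 ∈ T') (h2 : b 2 ∈ T') :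
    ({b 1, b 2} : Finset Plane) ∉ boundaryEdges K T := by
  intro h
  have hm : AffineMap.lineMap (b 1) (b 2) (1 / 2 : ℝ) ∈ frontier K.space := h.2.2 (by
    rw [hull_pair, segment_eq_image_lineMap]
    exact ⟨1 / 2, by norm_num, rfl⟩)
  refine hm.2 (mem_interior_space hT hT' hne hb h1 h2 ?_ ?_ ?_)
  all_goals rw [coord_lineMap]
  · rw [b.coord_apply_ne (by decide), b.coord_apply_ne (by decide)]; ring
  · rw [b.coord_apply_eq, b.coord_apply_ne (by decide)]; norm_num
  · rw [b.coord_apply_eq, b.coord_apply_ne (by decide)]; norm_num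

theorem mem_vertices_of_mem (hT : T ∈ triangles K) {x : Plane} (hx : x ∈ T) : x ∈ K.vertices :=
  K.down_closed hT.1 (by simpa using hx) (by simp)

namespace IsMesh

variable {Ω : Set Plane} {γ : ℝ} (hK : IsMesh Ω γ K)
include hK

theorem finite_triangles : (triangles K).Finite := hK.finite.subset fun _ h => h.1

theorem mem_space_iff {x : Plane} : x ∈ K.space ↔ ∃ T ∈ triangles K, x ∈ hull T := by
  rw [Geometry.SimplicialComplex.mem_space_iff]
  constructor
  · rintro ⟨s, hs, hx⟩
    obtain ⟨T, hT, hsT⟩ := hK.pure s hs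
    exact ⟨T, hT, convexHull_mono (by exact_mod_cast hsT) hx⟩
  · rintro ⟨T, hT, hx⟩
    exact ⟨T, hT.1, hx⟩

theorem space_eq : K.space = ⋃ T ∈ triangles K, hull T := by
  ext x; simp [hK.mem_space_iff]

theorem isCompact_space : IsCompact K.space := by
  rw [hK.space_eq]
  exact hK.finite_triangles.isCompact_biUnion fun T _ => isCompact_hull T

/-- An edge with a relative interior point on the boundary of the mesh lies on this boundary. -/
theorem pair_mem_boundaryEdges (hT : T ∈ triangles K) (hb : Set.range b = T) {y : Plane}
    (hy : y ∈ frontier K.space) (hy0 : b.coord 0 y = 0)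
    (hy1 : 0 < b.coord 1 y) (hy2 : 0 < b.coord 2 y) :
    ({b 1, b 2} : Finset Plane) ∈ boundaryEdges K T := by
  have hbT : ∀ i, b i ∈ T := fun i => by
    have : b i ∈ (T : Set Plane) := hb ▸ Set.mem_range_self i
    exact this
  have h12 : b 1 ≠ b 2 := fun h => by simpa using b.ind.injective h
  have huniq : ∀ T' ∈ triangles K, b 1 ∈ T' → b 2 ∈ T' → T = T' := by
    intro T' hT' h1 h2
    by_contra hne
    exact hy.2 (mem_interior_space hT hT' hne hb h1 h2 hy0 hy1 hy2)
  have hopen : openSegment ℝ (b 1) (b 2) ⊆ frontier K.space := by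
    intro x hx
    rw [openSegment_eq_image_lineMap] at hx
    obtain ⟨t, ht, rfl⟩ := hx
    set x : Plane := AffineMap.lineMap (b 1) (b 2) t with hxdef
    have hx0 : b.coord 0 x = 0 := by
      rw [hxdef, coord_lineMap, b.coord_apply_ne (by decide), b.coord_apply_ne (by decide)]; ring
    have hx1 : 0 < b.coord 1 x := by
      rw [hxdef, coord_lineMap, b.coord_apply_eq, b.coord_apply_ne (by decide)]
      linarith [ht.2]
    have hx2 : 0 < b.coord 2 x := by
      rw [hxdef, coord_lineMap, b.coord_apply_eq, b.coord_apply_ne (by decide)]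
      linarith [ht.1]
    have hxT : x ∈ hull T := by
      rw [mem_hull_iff hb]
      intro i
      fin_cases i
      · exact hx0.ge
      · exact hx1.le
      · exact hx2.le
    refine ⟨subset_closure (hull_subset_space hT hxT), fun hint => ?_⟩
    have hcl : IsClosed (⋃ T' ∈ triangles K \ {T}, hull T') :=
      (hK.finite_triangles.subset Set.sdiff_subset).isClosed_biUnion
        fun T' _ => (isCompact_hull T').isClosed
    -- For `t < 0` these points leave `T` across the edge. If `x` were interior to the mesh they
    -- would lie in other triangles, whose union is closed, so `x` would lie in a second triangle
    -- sharing the edge.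
    have hlim : Filter.Tendsto (fun t : ℝ => AffineMap.lineMap x (b 0) t) (𝓝[<] 0) (𝓝 x) := by
      have : ContinuousAt (fun t : ℝ => AffineMap.lineMap x (b 0) t) 0 :=
        AffineMap.lineMap_continuous.continuousAt
      have h := this.tendsto.mono_left (nhdsWithin_le_nhds (s := Set.Iio 0))
      simpa using h
    have hmem : x ∈ ⋃ T' ∈ triangles K \ {T}, hull T' := by
      refine hcl.mem_of_tendsto hlim ?_
      filter_upwards [hlim.eventually (mem_interior_iff_mem_nhds.1 hint), self_mem_nhdsWithin]
        with t ht ht0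
      obtain ⟨T', hT', hz⟩ := hK.mem_space_iff.1 ht
      refine Set.mem_biUnion (x := T') ⟨hT', ?_⟩ hz
      rintro rfl
      have h0 := (mem_hull_iff hb).1 hz 0
      rw [coord_lineMap, hx0, b.coord_apply_eq] at h0
      have : t < 0 := ht0
      linarith
    simp only [Set.mem_iUnion] at hmem
    obtain ⟨T', hT', hxT'⟩ := hmem
    exact hT'.2 (huniq T' hT'.1 (mem_of_coord_pos hT hT'.1 hb hxT hxT' hx1)
      (mem_of_coord_pos hT hT'.1 hb hxT hxT' hx2)).symm
  refine ⟨by simp [Finset.insert_subset_iff, hbT], Finset.card_pair h12, ?_⟩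
  rw [hull_pair, ← closure_openSegment]
  exact isClosed_frontier.closure_subset_iff.2 hopen

theorem frontier_subset_space : frontier K.space ⊆ K.space :=
  hK.isCompact_space.isClosed.frontier_subset

/-- A boundary point has a vanishing barycentric coordinate, which a permutation makes the first. If
another one vanishes the point is a vertex; otherwise it is in the relative interior of an edge, and
`pair_mem_boundaryEdges` applies. -/
theorem mem_vertices_or_mem_boundaryEdge {x : Plane} (hx : x ∈ frontier K.space) :
    x ∈ K.vertices ∨ ∃ T ∈ triangles K, ∃ e ∈ boundaryEdges K T, x ∈ hull e := by
  obtain ⟨T, hT, hxT⟩ := hK.mem_space_iff.1 (hK.frontier_subset_space hx)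
  obtain ⟨b₀, hb₀⟩ := exists_affineBasis' hT
  obtain ⟨b, hb, hx0⟩ : ∃ b : AffineBasis (Fin 3) ℝ Plane, Set.range b = T ∧ b.coord 0 x = 0 := by
    have h1 : x ∉ interior (hull T) := fun h => hx.2 (interior_mono (hull_subset_space hT) h)
    rw [mem_interior_hull_iff hb₀] at h1
    push Not at h1
    obtain ⟨i, hi⟩ := h1
    refine ⟨b₀.reindex (Equiv.swap 0 i), ?_, ?_⟩
    · rw [AffineBasis.coe_reindex, (Equiv.surjective _).range_comp, hb₀]
    · rw [AffineBasis.coord_reindex]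
      simpa using le_antisymm hi ((mem_hull_iff hb₀).1 hxT i)
  have hbT : ∀ i, b i ∈ T := fun i => by
    have : b i ∈ (T : Set Plane) := hb ▸ Set.mem_range_self i
    exact this
  have hsum := b.sum_coord_apply_eq_one x
  rw [Fin.sum_univ_three, hx0, zero_add] at hsum
  have hnn := (mem_hull_iff hb).1 hxT
  have hxl : x = AffineMap.lineMap (b 1) (b 2) (b.coord 2 x) := by
    refine b.ext_elem fun i => ?_
    rw [coord_lineMap]
    fin_cases i
    · simp [b.coord_apply, hx0]
    · simp [b.coord_apply]; linarith
    · simp [b.coord_apply]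
  rcases (hnn 1).eq_or_lt with e1 | p1
  · left
    rw [show b.coord 2 x = 1 by linarith, AffineMap.lineMap_apply_one] at hxl
    rw [hxl]
    exact mem_vertices_of_mem hT (hbT 2)
  rcases (hnn 2).eq_or_lt with e2 | p2
  · left
    rw [← e2, AffineMap.lineMap_apply_zero] at hxl
    rw [hxl]
    exact mem_vertices_of_mem hT (hbT 1)
  refine Or.inr ⟨T, hT, _, hK.pair_mem_boundaryEdges hT hb hx hx0 p1 p2, ?_⟩
  rw [hull_pair, segment_eq_image_lineMap]
  exact ⟨_, ⟨hnn 2, by linarith⟩, hxl.symm⟩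

/-- Gluing functions on the triangles that agree on the intersections. -/
theorem exists_glue (r : Finset Plane → Plane → ℝ) (hr : ∀ T ∈ triangles K, Continuous (r T))
    (hagree : ∀ T ∈ triangles K, ∀ T' ∈ triangles K, ∀ x ∈ hull T, x ∈ hull T' → r T x = r T' x) :
    ∃ g : Plane → ℝ, (∀ x ∉ K.space, g x = 0) ∧ ContinuousOn g K.space ∧
      ∀ T ∈ triangles K, Set.EqOn g (r T) (hull T) := by
  classical
  let g : Plane → ℝ := fun x =>
    if h : ∃ T ∈ triangles K, x ∈ hull T then r h.choose x else 0
  have hg : ∀ T ∈ triangles K, Set.EqOn g (r T) (hull T) := by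
    intro T hT x hx
    have h : ∃ T ∈ triangles K, x ∈ hull T := ⟨T, hT, hx⟩
    simp only [g, dif_pos h]
    exact hagree _ h.choose_spec.1 _ hT _ h.choose_spec.2 hx
  refine ⟨g, fun x hx => ?_, ?_, hg⟩
  · rw [hK.mem_space_iff] at hx
    simp only [g, dif_neg hx]
  · have : Finite (triangles K) := hK.finite_triangles
    rw [hK.space_eq, Set.biUnion_eq_iUnion]
    exact (locallyFinite_of_finite _).continuousOn_iUnion
      (fun T => (isCompact_hull _).isClosed)
      fun T => (hr T T.2).continuousOn.congr (hg T T.2)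

/-- Gluing functions on the triangles that vanish on all edges off the boundary of the mesh. -/
theorem exists_glue_of_boundary (r : Finset Plane → Plane → ℝ)
    (hr : ∀ T ∈ triangles K, Continuous (r T))
    (h : ∀ T ∈ triangles K, r T = 0 ∨ ∃ b : AffineBasis (Fin 3) ℝ Plane, Set.range b = T ∧
      ({b 1, b 2} : Finset Plane) ∈ boundaryEdges K T ∧
      (∀ x, b.coord 1 x = 0 → r T x = 0) ∧ ∀ x, b.coord 2 x = 0 → r T x = 0) :
    ∃ g : Plane → ℝ, (∀ x ∉ K.space, g x = 0) ∧ ContinuousOn g K.space ∧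
      ∀ T ∈ triangles K, Set.EqOn g (r T) (hull T) := by
  -- A point of two triangles with positive coordinates at `b 1` and `b 2` would make their edge a
  -- common one, which is not on the boundary. So the pieces vanish wherever triangles meet.
  have hz : ∀ T ∈ triangles K, ∀ T' ∈ triangles K, T ≠ T' → ∀ x ∈ hull T, x ∈ hull T' →
      r T x = 0 := by
    intro T hT T' hT' hne x hx hx'
    rcases h T hT with h0 | ⟨b, hb, hbe, h1, h2⟩
    · rw [h0]; rfl
    · have hnn := (mem_hull_iff hb).1 hx
      rcases (hnn 1).eq_or_lt with e1 | p1
      · exact h1 x e1.symm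
      rcases (hnn 2).eq_or_lt with e2 | p2
      · exact h2 x e2.symm
      exact absurd hbe (pair_notMem_boundaryEdges hT hT' hne hb
        (mem_of_coord_pos hT hT' hb hx hx' p1) (mem_of_coord_pos hT hT' hb hx hx' p2))
  refine hK.exists_glue r hr fun T hT T' hT' x hx hx' => ?_
  by_cases hne : T = T'
  · rw [hne]
  · rw [hz T hT T' hT' hne x hx hx', hz T' hT' T hT (Ne.symm hne) x hx' hx]

end IsMesh

end MeshTopology

/-! ### The gradient of piecewise polynomials as a map into `L²` -/

section Gradient

/-- Piecewise polynomials of degree at most `k`. -/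
def piecewisePoly (k : ℕ) (K : Geometry.SimplicialComplex ℝ Plane) :
    Submodule ℝ (Plane → ℝ) where
  carrier := {w | ∀ T ∈ triangles K, ∃ p, IsPoly k p ∧ Set.EqOn w p (hull T)}
  zero_mem' := fun _ _ => ⟨_, IsPoly.const k 0, fun _ _ => rfl⟩
  add_mem' := by
    intro v w hv hw T hT
    obtain ⟨p, hp, hvp⟩ := hv T hT
    obtain ⟨q, hq, hwq⟩ := hw T hT
    exact ⟨_, hp.add hq, fun x hx => by simp [hvp hx, hwq hx]⟩
  smul_mem' := by
    intro c v hv T hT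
    obtain ⟨p, hp, hvp⟩ := hv T hT
    exact ⟨_, hp.const_mul c, fun x hx => by simp [hvp hx]⟩

theorem V_le_piecewisePoly (k : ℕ) (K : Geometry.SimplicialComplex ℝ Plane) :
    V k K ≤ piecewisePoly k K := fun _ hv => hv.2.2.2

theorem W_le_piecewisePoly (Ω : Set Plane) (k : ℕ) (K : Geometry.SimplicialComplex ℝ Plane) :
    W Ω k K ≤ piecewisePoly k K := fun _ hw T hT => by
  obtain ⟨p, hp, hwp, -⟩ := hw.2.2.2 T hT
  exact ⟨p, hp, hwp⟩

variable {K : Geometry.SimplicialComplex ℝ Plane} {T : Finset Plane} {k : ℕ} {Ω : Set Plane} {γ : ℝ}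
  {u v w p : Plane → ℝ}

theorem eventuallyEq_of_mem_interior (h : Set.EqOn w p (hull T)) {x : Plane}
    (hx : x ∈ interior (hull T)) : w =ᶠ[𝓝 x] p := by
  filter_upwards [mem_interior_iff_mem_nhds.1 hx] with y hy using h hy

theorem gradient_eq_of_mem_interior (h : Set.EqOn w p (hull T)) {x : Plane}
    (hx : x ∈ interior (hull T)) : gradient w x = gradient p x :=
  (eventuallyEq_of_mem_interior h hx).gradient_eq

theorem measurable_gradient (w : Plane → ℝ) : Measurable (gradient w) :=
  (InnerProductSpace.toDual ℝ Plane).symm.continuous.measurable.comp (measurable_fderiv ℝ w)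

theorem IsPoly.continuous_gradient (hp : IsPoly k p) : Continuous (gradient p) :=
  (InnerProductSpace.toDual ℝ Plane).symm.continuous.comp
    (hp.contDiff.continuous_fderiv (by simp))

theorem IsPoly.integrableOn_norm_gradient_sq (hp : IsPoly k p) (T : Finset Plane) :
    IntegrableOn (fun x => ‖gradient p x‖ ^ 2) (hull T) :=
  (hp.continuous_gradient.norm.pow 2).continuousOn.integrableOn_compact (isCompact_hull T)

theorem interior_hull_ae_eq (T : Finset Plane) :
    interior (hull T) =ᵐ[(volume : Measure Plane)] hull T :=
  interior_ae_eq_of_null_frontier ((convex_convexHull ℝ _).addHaar_frontier volume)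

/-- On the sides of the triangle the gradient of `w` need not be that of `p`, but the frontier of a
convex set is a null set. -/
theorem setIntegral_norm_gradient_sq_congr (h : Set.EqOn w p (hull T)) :
    ∫ x in hull T, ‖gradient w x‖ ^ 2 = ∫ x in hull T, ‖gradient p x‖ ^ 2 := by
  rw [← setIntegral_congr_set (interior_hull_ae_eq T), ← setIntegral_congr_set (interior_hull_ae_eq T)]
  exact setIntegral_congr_fun isOpen_interior.measurableSet fun x hx => by
    simp only [gradient_eq_of_mem_interior h hx]

/-- A polynomial whose gradient vanishes almost everywhere on a triangle is constant. -/
theorem IsPoly.const_of_integral_gradient_eq_zero (hT : T ∈ triangles K) (hp : IsPoly k p)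
    (h : ∫ x in hull T, ‖gradient p x‖ ^ 2 = 0) (x y : Plane) : p x = p y := by
  refine is_const_of_fderiv_eq_zero hp.differentiable (fun x => ?_) x y
  obtain ⟨b, hb⟩ := exists_affineBasis' hT
  have hne : (interior (hull T)).Nonempty := by
    rw [hull, ← hb]
    exact ⟨_, b.centroid_mem_interior_convexHull⟩
  obtain ⟨z, hz⟩ := hne
  obtain ⟨r, hr, hball⟩ := Metric.nhds_basis_closedBall.mem_iff.1 (mem_interior_iff_mem_nhds.1 hz)
  -- The radius factor is chosen after `x`, so the inverse inequality reaches any point of the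
  -- plane.
  obtain ⟨C, hC, H⟩ := exists_norm_gradient_sq_le_integral k (dist x z / r)
  have h1 := H p hp z r hr x (by rw [div_mul_cancel₀ _ hr.ne'])
  have h2 : ∫ y in Metric.closedBall z r, ‖gradient p y‖ ^ 2 ≤ 0 := by
    rw [← h]
    exact setIntegral_mono_set (hp.integrableOn_norm_gradient_sq T)
      (Filter.Eventually.of_forall fun x => sq_nonneg _) (Filter.Eventually.of_forall hball)
  have h3 : r ^ 2 * ‖gradient p x‖ ^ 2 ≤ 0 := h1.trans (mul_nonpos_of_nonneg_of_nonpos hC.le h2)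
  have h4 : ‖gradient p x‖ = 0 := by
    by_contra hne
    have : 0 < r ^ 2 * ‖gradient p x‖ ^ 2 := by positivity
    linarith
  rwa [norm_gradient, norm_eq_zero] at h4

namespace IsMesh

variable (hK : IsMesh Ω γ K)
include hK

theorem space_ae_eq :
    (⋃ T ∈ hK.finite_triangles.toFinset, interior (hull T)) =ᵐ[(volume : Measure Plane)] K.space := by
  rw [hK.space_eq]
  simp only [Set.Finite.mem_toFinset]
  exact Filter.EventuallyEq.countable_bUnion hK.finite_triangles.countable
    fun T _ => interior_hull_ae_eq T

theorem ae_mem_interior :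
    ∀ᵐ x ∂(volume : Measure Plane).restrict K.space, ∃ T ∈ triangles K, x ∈ interior (hull T) := by
  rw [← Measure.restrict_congr_set hK.space_ae_eq]
  filter_upwards [ae_restrict_mem (Finset.measurableSet_biUnion _
    fun T _ => isOpen_interior.measurableSet)] with x hx
  simpa using hx

theorem setIntegral_space {f : Plane → ℝ} (hf : ∀ T ∈ triangles K, IntegrableOn f (hull T)) :
    ∫ x in K.space, f x = ∑ T ∈ hK.finite_triangles.toFinset, ∫ x in hull T, f x := by
  rw [← setIntegral_congr_set hK.space_ae_eq, integral_biUnion_finset]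
  · exact Finset.sum_congr rfl fun T _ => setIntegral_congr_set (interior_hull_ae_eq T)
  · exact fun T _ => isOpen_interior.measurableSet
  · intro T hT T' hT' hne
    rw [Function.onFun, Set.disjoint_left]
    intro x hx hx'
    exact hne (eq_of_mem_interior (by simpa using hT) (by simpa using hT') hx (interior_subset hx'))
  · exact fun T hT => (hf T (by simpa using hT)).mono_set interior_subset

theorem ae_differentiableAt (hw : w ∈ piecewisePoly k K) :
    ∀ᵐ x ∂(volume : Measure Plane).restrict K.space, DifferentiableAt ℝ w x := by
  filter_upwards [hK.ae_mem_interior] with x hx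
  obtain ⟨T, hT, hx⟩ := hx
  obtain ⟨p, hp, hwp⟩ := hw T hT
  exact (hp.differentiable x).congr_of_eventuallyEq (eventuallyEq_of_mem_interior hwp hx)

theorem memLp_gradient (hw : w ∈ piecewisePoly k K) :
    MemLp (gradient w) 2 ((volume : Measure Plane).restrict K.space) := by
  have : IsFiniteMeasure ((volume : Measure Plane).restrict K.space) :=
    ⟨by simpa using hK.isCompact_space.measure_lt_top⟩
  have hB : ∀ T ∈ triangles K, ∃ C, ∀ x ∈ interior (hull T), ‖gradient w x‖ ≤ C := by
    intro T hT
    obtain ⟨p, hp, hwp⟩ := hw T hT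
    obtain ⟨C, hC⟩ := (isCompact_hull T).exists_bound_of_continuousOn
      hp.continuous_gradient.continuousOn
    refine ⟨C, fun x hx => ?_⟩
    rw [gradient_eq_of_mem_interior hwp hx]
    exact hC x (interior_subset hx)
  choose! C hC using hB
  refine MemLp.of_bound (measurable_gradient w).aestronglyMeasurable
    (∑ T ∈ hK.finite_triangles.toFinset, |C T|) ?_
  filter_upwards [hK.ae_mem_interior] with x hx
  obtain ⟨T, hT, hx⟩ := hx
  exact (hC T hT x hx).trans ((le_abs_self _).trans
    (Finset.single_le_sum (f := fun T => |C T|) (fun _ _ => abs_nonneg _) (by simpa using hT)))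

/-- The gradient as a linear map from piecewise polynomials to `L²`. -/
def gradL2 (k : ℕ) : piecewisePoly k K →ₗ[ℝ]
    Lp Plane 2 ((volume : Measure Plane).restrict K.space) where
  toFun w := (hK.memLp_gradient w.2).toLp
  map_add' v w := by
    rw [← MemLp.toLp_add, MemLp.toLp_eq_toLp_iff]
    filter_upwards [hK.ae_differentiableAt v.2, hK.ae_differentiableAt w.2] with x hv hw
    simp only [gradient, Submodule.coe_add, Pi.add_apply]
    rw [fderiv_add hv hw, map_add]
  map_smul' c w := by
    rw [RingHom.id_apply, ← MemLp.toLp_const_smul, MemLp.toLp_eq_toLp_iff]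
    filter_upwards [hK.ae_differentiableAt w.2] with x hw
    simp only [gradient, Submodule.coe_smul, Pi.smul_apply]
    rw [fderiv_const_smul hw, map_smul]

theorem aForm_eq_inner (w v : piecewisePoly k K) :
    aForm K w v = inner ℝ (hK.gradL2 k w) (hK.gradL2 k v) := by
  rw [L2.inner_def, aForm]
  refine integral_congr_ae ?_
  filter_upwards [(hK.memLp_gradient w.2).coeFn_toLp, (hK.memLp_gradient v.2).coeFn_toLp]
    with x h1 h2
  simp only [gradL2, LinearMap.coe_mk, AddHom.coe_mk, h1, h2]

theorem gradNorm_eq_norm (w : piecewisePoly k K) : gradNorm K w = ‖hK.gradL2 k w‖ := by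
  have h : ∫ x in K.space, ‖gradient (w : Plane → ℝ) x‖ ^ 2 = aForm K w w :=
    integral_congr_ae (Filter.Eventually.of_forall fun x => by
      simp only [real_inner_self_eq_norm_sq])
  rw [gradNorm, h, hK.aForm_eq_inner, real_inner_self_eq_norm_sq, Real.sqrt_sq (norm_nonneg _)]

theorem integrableOn_norm_gradient_sq (hw : w ∈ piecewisePoly k K) (hT : T ∈ triangles K) :
    IntegrableOn (fun x => ‖gradient w x‖ ^ 2) (hull T) :=
  ((hK.memLp_gradient hw).integrable_norm_pow (by simp)).mono_measure
    (Measure.restrict_mono_set _ (hull_subset_space hT))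

theorem gradNorm_le_half (hu : u ∈ piecewisePoly k K) (hw : w ∈ piecewisePoly k K)
    (h : ∀ T ∈ triangles K, ∫ x in hull T, ‖gradient u x‖ ^ 2 ≤
      1 / 4 * ∫ x in hull T, ‖gradient w x‖ ^ 2) :
    gradNorm K u ≤ 1 / 2 * gradNorm K w := by
  have h1 : ∫ x in K.space, ‖gradient u x‖ ^ 2 ≤ 1 / 4 * ∫ x in K.space, ‖gradient w x‖ ^ 2 := by
    rw [hK.setIntegral_space fun T hT => hK.integrableOn_norm_gradient_sq hu hT,
      hK.setIntegral_space fun T hT => hK.integrableOn_norm_gradient_sq hw hT, Finset.mul_sum]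
    exact Finset.sum_le_sum fun T hT => h T (by simpa using hT)
  calc gradNorm K u ≤ Real.sqrt (1 / 4 * ∫ x in K.space, ‖gradient w x‖ ^ 2) := Real.sqrt_le_sqrt h1
    _ = _ := by
      rw [Real.sqrt_mul (by norm_num), gradNorm, show (1 / 4 : ℝ) = (1 / 2) ^ 2 by norm_num,
        Real.sqrt_sq (by norm_num)]

/-- A piecewise polynomial with zero gradient that vanishes at the boundary vertices is zero. -/
theorem eq_zero_of_gradNorm_eq_zero (hw : w ∈ piecewisePoly k K) (hw0 : ∀ x ∉ K.space, w x = 0)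
    (hwv : ∀ x ∈ K.vertices, x ∈ frontier K.space → w x = 0) (h : gradNorm K w = 0) : w = 0 := by
  have hnn : ∀ T, 0 ≤ ∫ x in hull T, ‖gradient w x‖ ^ 2 := fun T =>
    integral_nonneg fun x => sq_nonneg _
  have h0 : ∫ x in K.space, ‖gradient w x‖ ^ 2 = 0 := by
    rw [gradNorm, Real.sqrt_eq_zero (integral_nonneg fun x => sq_nonneg _)] at h
    exact h
  rw [hK.setIntegral_space fun T hT => hK.integrableOn_norm_gradient_sq hw hT,
    Finset.sum_eq_zero_iff_of_nonneg fun T _ => hnn T] at h0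
  have hconst : ∀ T ∈ triangles K, ∀ x ∈ hull T, ∀ y ∈ hull T, w x = w y := by
    intro T hT x hx y hy
    obtain ⟨p, hp, hwp⟩ := hw T hT
    rw [hwp hx, hwp hy]
    refine hp.const_of_integral_gradient_eq_zero hT ?_ x y
    rw [← setIntegral_norm_gradient_sq_congr hwp]
    exact h0 T (by simpa using hT)
  by_contra hne
  obtain ⟨x, hx⟩ := Function.ne_iff.1 hne
  simp only [Pi.zero_apply] at hx
  have hxs : x ∈ K.space := by
    by_contra hxs
    exact hx (hw0 x hxs)
  obtain ⟨T₀, hT₀, hxT₀⟩ := hK.mem_space_iff.1 hxs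
  -- An extremal argument replaces connectedness of the mesh: among the vertices with the value `w
  -- x`, the rightmost one must lie on the boundary of the mesh, where `w` vanishes.
  let S : Set Plane := {y | ∃ T ∈ triangles K, y ∈ T ∧ w y = w x}
  have hSf : S.Finite := (hK.finite_triangles.biUnion fun T _ => T.finite_toSet).subset (by
    rintro y ⟨T, hT, hy, -⟩
    exact Set.mem_biUnion hT hy)
  have hmem : ∀ {T : Finset Plane} {y : Plane}, y ∈ T → y ∈ hull T := fun hy =>
    subset_convexHull ℝ _ (by exact_mod_cast hy)
  have hSne : S.Nonempty := by
    obtain ⟨y, hy⟩ : T₀.Nonempty := by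
      rw [← Finset.card_pos, hT₀.2]; norm_num
    exact ⟨y, T₀, hT₀, hy, hconst T₀ hT₀ _ (hmem hy) _ hxT₀⟩
  obtain ⟨y, ⟨T, hT, hyT, hyx⟩, hmax⟩ := hSf.exists_maximalFor (fun y => y 0) S hSne
  have hmax' : ∀ z ∈ S, z 0 ≤ y 0 := fun z hz => by
    by_contra! hlt
    exact absurd (hmax hz hlt.le) (not_le.2 hlt)
  refine hx ?_
  rw [← hyx]
  refine hwv y (mem_vertices_of_mem hT hyT) ⟨subset_closure (hull_subset_space hT (hmem hyT)), ?_⟩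
  intro hint
  have hcl : IsClosed (⋃ T ∈ {T ∈ triangles K | y ∉ hull T}, hull T) :=
    (hK.finite_triangles.subset fun _ h => h.1).isClosed_biUnion
      fun T' _ => (isCompact_hull T').isClosed
  have hycl : y ∉ ⋃ T ∈ {T ∈ triangles K | y ∉ hull T}, hull T := by
    simp only [Set.mem_iUnion, not_exists]
    exact fun T hT hy => hT.2 hy
  have hlim : Filter.Tendsto (fun t : ℝ => y + t • EuclideanSpace.single 0 (1 : ℝ))
      (𝓝[>] 0) (𝓝 y) := by
    have : ContinuousAt (fun t : ℝ => y + t • EuclideanSpace.single 0 (1 : ℝ)) 0 := by fun_prop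
    simpa using this.tendsto.mono_left (nhdsWithin_le_nhds (s := Set.Ioi 0))
  -- If `y` were interior, a small step to the right would end in a triangle that contains `y`.
  -- There `w` is constant, so its vertices belong to `S` and none is to the right of `y`, a
  -- contradiction.
  obtain ⟨t, ⟨ht1, ht2⟩, ht0⟩ := (((hlim.eventually_mem (mem_interior_iff_mem_nhds.1 hint)).and
    (hlim.eventually_mem (hcl.isOpen_compl.mem_nhds hycl))).and self_mem_nhdsWithin).exists
  have ht0' : 0 < t := ht0
  obtain ⟨T', hT', hz⟩ := hK.mem_space_iff.1 ht1
  have hyT' : y ∈ hull T' := by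
    by_contra hy
    exact ht2 (Set.mem_biUnion (x := T') ⟨hT', hy⟩ hz)
  have hle : hull T' ⊆ {z | z 0 ≤ y 0} := by
    refine convexHull_min (fun z hz => hmax' z ⟨T', hT', hz, ?_⟩) ?_
    · rw [← hyx]
      exact hconst T' hT' _ (hmem hz) _ hyT'
    · exact convex_halfSpace_le (EuclideanSpace.proj (𝕜 := ℝ) (0 : Fin 2)).toLinearMap.isLinear _
  have := hle hz
  simp at this
  linarith

end IsMesh

end Gradient

/-! ### Passing between `W` and `V` by small corrections -/

section Approximation

variable {K : Geometry.SimplicialComplex ℝ Plane} {T : Finset Plane} {k : ℕ} {Ω : Set Plane} {γ : ℝ}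
  {u v w p : Plane → ℝ}

/-- The restriction of a polynomial of degree at most `k` to a line is determined by its values
at `k + 1` points. -/
theorem IsPoly.eq_zero_on_line (hp : IsPoly k p) (hk : 0 < k) {A B : Plane}
    (h : ∀ l ≤ k, p (AffineMap.lineMap A B ((l : ℝ) / k)) = 0) (t : ℝ) :
    p (AffineMap.lineMap A B t) = 0 := by
  obtain ⟨q, hq, hp⟩ := hp
  let f : Fin 2 → Polynomial ℝ := fun i => Polynomial.C (B i - A i) * Polynomial.X + Polynomial.C (A i)
  let P : Polynomial ℝ := MvPolynomial.aeval f q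
  have hdeg : P.natDegree ≤ k := by
    have := MvPolynomial.aeval_natDegree_le q hq f (n := 1) fun i => Polynomial.natDegree_linear_le
    simpa using this
  have heval : ∀ t, p (AffineMap.lineMap A B t) = P.eval t := by
    intro t
    rw [hp, ← Polynomial.coe_evalRingHom, MvPolynomial.map_aeval]
    have h1 : (Polynomial.evalRingHom t).comp (algebraMap ℝ (Polynomial ℝ)) = RingHom.id ℝ := by
      ext; simp
    rw [h1]
    change MvPolynomial.eval _ q = MvPolynomial.eval _ q
    refine congrArg (fun g => MvPolynomial.eval g q) (funext fun i => ?_)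
    simp [f, AffineMap.lineMap_apply]
    ring
  have hP : P = 0 := by
    refine Polynomial.eq_zero_of_natDegree_lt_card_of_eval_eq_zero (ι := Fin (k + 1)) P
      (f := fun l => (l : ℝ) / k) ?_ ?_ ?_
    · intro i j hij
      have hk' : (k : ℝ) ≠ 0 := by positivity
      simp only at hij
      rw [div_left_inj' hk'] at hij
      exact Fin.ext (by exact_mod_cast hij)
    · intro l
      rw [← heval]
      exact h l (by omega)
    · simp; omega
  rw [heval, hP, Polynomial.eval_zero]

/-- The equidistant points on the edge opposite to the vertex `b 0`. -/
def edgePoint (b : AffineBasis (Fin 3) ℝ Plane) (k j : ℕ) : Plane :=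
  AffineMap.lineMap (b 1) (b 2) ((j : ℝ) / k)

theorem coord_one_edgePoint_ray (b : AffineBasis (Fin 3) ℝ Plane) (k j : ℕ) (τ : ℝ) :
    b.coord 1 (edgePoint b k j + τ • (edgePoint b k j - b 0)) = (1 + τ) * (1 - (j : ℝ) / k) := by
  have h : edgePoint b k j + τ • (edgePoint b k j - b 0) =
      AffineMap.lineMap (b 0) (edgePoint b k j) (1 + τ) := by
    rw [AffineMap.lineMap_apply, vsub_eq_sub, vadd_eq_add]; module
  rw [h, coord_lineMap, edgePoint, coord_lineMap, b.coord_apply_eq, b.coord_apply_ne (by decide),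
    b.coord_apply_ne (by decide)]
  ring

theorem coord_two_edgePoint_ray (b : AffineBasis (Fin 3) ℝ Plane) (k j : ℕ) (τ : ℝ) :
    b.coord 2 (edgePoint b k j + τ • (edgePoint b k j - b 0)) = (1 + τ) * ((j : ℝ) / k) := by
  have h : edgePoint b k j + τ • (edgePoint b k j - b 0) =
      AffineMap.lineMap (b 0) (edgePoint b k j) (1 + τ) := by
    rw [AffineMap.lineMap_apply, vsub_eq_sub, vadd_eq_add]; module
  rw [h, coord_lineMap, edgePoint, coord_lineMap, b.coord_apply_eq, b.coord_apply_ne (by decide),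
    b.coord_apply_ne (by decide)]
  ring

/-- Interpolation at points moved along the rays from `b 0` thus stays diagonal: each coefficient is
only scaled. -/
theorem edgeBubble_ray (b : AffineBasis (Fin 3) ℝ Plane) (a : ℕ → ℝ) {j : ℕ}
    (hj : j ∈ Finset.Ioo 0 k) (τ : ℝ) :
    edgeBubble b k a (edgePoint b k j + τ • (edgePoint b k j - b 0)) = (1 + τ) ^ k * a j :=
  edgeBubble_node hj (coord_one_edgePoint_ray b k j τ) (coord_two_edgePoint_ray b k j τ)

theorem edgeBubble_edgePoint (b : AffineBasis (Fin 3) ℝ Plane) (a : ℕ → ℝ) {j : ℕ}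
    (hj : j ∈ Finset.Ioo 0 k) : edgeBubble b k a (edgePoint b k j) = a j := by
  simpa using edgeBubble_ray b a hj 0

/-- The inradius is a supremum. A disk of more than half that radius avoids proving that it is
attained, at the price of the factor `2`. -/
theorem IsMesh.exists_closedBall_subset (hK : IsMesh Ω γ K) (hT : T ∈ triangles K) :
    ∃ z r, 0 < r ∧ Metric.closedBall z r ⊆ hull T ∧ diamT T ≤ 2 * γ * r := by
  have hreg := hK.regular T hT
  obtain ⟨A, hA, B, hB, hAB⟩ := Finset.one_lt_card.1 (by rw [hT.2]; norm_num : 1 < T.card)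
  have hbd := (isCompact_hull T).isBounded
  have hd : 0 < diamT T := (dist_pos.2 hAB).trans_le (Metric.dist_le_diam_of_mem hbd
    (subset_convexHull ℝ _ hA) (subset_convexHull ℝ _ hB))
  have hi : 0 ≤ inradius T := Real.sSup_nonneg fun r hr => hr.1
  have hpos : 0 < γ * inradius T := hd.trans_le hreg
  have hi' : 0 < inradius T := by
    refine hi.lt_of_ne fun h => ?_
    rw [← h, mul_zero] at hpos
    exact lt_irrefl _ hpos
  have hγ : 0 < γ := pos_of_mul_pos_left hpos hi
  obtain ⟨r, ⟨-, z, hz⟩, hr⟩ := exists_lt_of_lt_csSup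
    (s := {r : ℝ | 0 ≤ r ∧ ∃ c, Metric.closedBall c r ⊆ hull T})
    (by
      by_contra hne
      rw [Set.not_nonempty_iff_eq_empty] at hne
      rw [inradius, hne, Real.sSup_empty] at hi'
      exact lt_irrefl _ hi') (half_lt_self hi')
  refine ⟨z, r, (half_pos hi').trans hr, hz, hreg.trans ?_⟩
  have : inradius T ≤ 2 * r := by
    change inradius T / 2 < r at hr
    linarith
  nlinarith

theorem IsMesh.diamT_le_meshSize (hK : IsMesh Ω γ K) (hT : T ∈ triangles K) :
    diamT T ≤ meshSize K :=
  le_csSup (hK.finite_triangles.image _).bddAbove ⟨T, hT, rfl⟩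

/-- The nodes on `∂Ω` attached to a triangle of a fine mesh. -/
theorem IsCkDomain.exists_nodes (hk : 2 ≤ k) (hΩ : IsCkDomain k Ω) (γ : ℝ) {η : ℝ} (hη : 0 < η) :
    ∃ h₀ > 0, ∀ K, IsMesh Ω γ K → meshSize K ≤ h₀ → ∀ T ∈ triangles K, ∀ e ∈ boundaryEdges K T,
      ∃ (b : AffineBasis (Fin 3) ℝ Plane) (τ : ℕ → ℝ), Set.range b = T ∧ {b 1, b 2} = e ∧
        (∀ j, |τ j| ≤ η) ∧ ∀ P, IsCurvedNode Ω k K T P ↔ ∃ j ∈ Finset.Ioo 0 k,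
          P = edgePoint b k j + τ j • (edgePoint b k j - b 0) := by
  obtain ⟨h₀, hh₀, H⟩ := hΩ.exists_nearestIntersection hk (2 * γ) hη
  refine ⟨h₀, hh₀, fun K hK hsize T hT e he => ?_⟩
  obtain ⟨A, B, hAB, rfl⟩ := Finset.card_eq_two.1 he.2.1
  obtain ⟨O, hO⟩ : ∃ O, T \ {A, B} = {O} := by
    rw [← Finset.card_eq_one, Finset.card_sdiff_of_subset he.1, hT.2, he.2.1]
  have hTO : T = {O, A, B} := by
    rw [Finset.insert_eq, ← hO, Finset.sdiff_union_of_subset he.1]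
  obtain ⟨b, hb0, hb1, hb2, hb⟩ := exists_affineBasis hT hTO
  obtain ⟨z, r, hr, hball, hdiam⟩ := hK.exists_closedBall_subset hT
  have hfr : ∀ x ∈ ({A, B} : Finset Plane), x ∈ frontier Ω := fun x hx =>
    hK.vertices_mem x (mem_vertices_of_mem hT (he.1 hx))
      (he.2.2 (subset_convexHull ℝ _ (by exact_mod_cast hx)))
  have hhull : hull T = convexHull ℝ {O, A, B} := by rw [hTO, hull]; simp
  rw [diamT, hhull] at hdiam
  rw [hhull] at hball
  have hsz := (hK.diamT_le_meshSize hT).trans hsize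
  rw [diamT, hhull] at hsz
  have hτ : ∀ j : ℕ, ∃ τ : ℝ, |τ| ≤ η ∧ (j ∈ Finset.Ioo 0 k → ∀ P,
      IsNearestIntersection Ω O (edgePoint b k j) P ↔
        P = edgePoint b k j + τ • (edgePoint b k j - b 0)) := by
    intro j
    by_cases hj : j ∈ Finset.Ioo 0 k
    · have hj' := Finset.mem_Ioo.1 hj
      have hk0 : (0 : ℝ) < k := by exact_mod_cast (by omega : 0 < k)
      obtain ⟨τ, h1, h2⟩ := H O A B z r hr hball hdiam hsz (hfr A (by simp)) (hfr B (by simp))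
        ((j : ℝ) / k) ⟨by positivity, by
          rw [div_le_one hk0]; exact_mod_cast hj'.2.le⟩
      exact ⟨τ, h1, fun _ => by rw [edgePoint, hb0, hb1, hb2]; exact h2⟩
    -- A default parameter at indices without a node, so that the bound on `τ` holds for every `j`.
    · exact ⟨0, by simpa using hη.le, fun h => absurd h hj⟩
  choose τ hτ1 hτ2 using hτ
  refine ⟨b, τ, hb, by rw [hb1, hb2], hτ1, fun P => ?_⟩
  constructor
  · rintro ⟨e', he', A', hA', B', hB', hAB', O', hO', hOe, j, hj0, hjk, hP⟩
    obtain rfl := hK.boundaryEdges_subsingleton T hT he he'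
    have hOO : O' = O := by
      rw [← Finset.mem_singleton, ← hO, Finset.mem_sdiff]
      exact ⟨hO', hOe⟩
    subst hOO
    simp only [Finset.mem_insert, Finset.mem_singleton] at hA' hB'
    have hk0 : (k : ℝ) ≠ 0 := by exact_mod_cast (by omega : k ≠ 0)
    -- A node may be described with the ends of the edge in either order; exchanging them turns `j`
    -- into `k - j`.
    rcases hA' with rfl | rfl <;> rcases hB' with rfl | rfl
    · exact absurd rfl hAB'
    · have hj : j ∈ Finset.Ioo 0 k := Finset.mem_Ioo.2 ⟨hj0, hjk⟩
      refine ⟨j, hj, (hτ2 j hj P).1 ?_⟩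
      rwa [edgePoint, hb1, hb2]
    · have hj : k - j ∈ Finset.Ioo 0 k := Finset.mem_Ioo.2 ⟨by omega, by omega⟩
      refine ⟨k - j, hj, (hτ2 _ hj P).1 ?_⟩
      rw [edgePoint, hb1, hb2, Nat.cast_sub hjk.le, sub_div, div_self hk0,
        AffineMap.lineMap_apply_one_sub]
      exact hP
    · exact absurd rfl hAB'
  · rintro ⟨j, hj, rfl⟩
    have hj' := Finset.mem_Ioo.1 hj
    refine ⟨_, he, A, by simp, B, by simp, hAB, O, by simp [hTO], ?_, j, hj'.1, hj'.2, ?_⟩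
    · have : O ∈ T \ {A, B} := by rw [hO]; simp
      exact (Finset.mem_sdiff.1 this).2
    · have := (hτ2 j hj _).2 rfl
      rwa [edgePoint, hb1, hb2] at this ⊢

/-- A polynomial on a triangle that vanishes on the edges off the boundary of the mesh. -/
def IsBoundaryBubble (k : ℕ) (K : Geometry.SimplicialComplex ℝ Plane) (T : Finset Plane)
    (r : Plane → ℝ) : Prop :=
  IsPoly k r ∧ (r = 0 ∨ ∃ b : AffineBasis (Fin 3) ℝ Plane, Set.range b = T ∧
    ({b 1, b 2} : Finset Plane) ∈ boundaryEdges K T ∧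
    (∀ x, b.coord 1 x = 0 → r x = 0) ∧ ∀ x, b.coord 2 x = 0 → r x = 0)

theorem isBoundaryBubble_zero : IsBoundaryBubble k K T 0 := ⟨IsPoly.const k 0, Or.inl rfl⟩

theorem isBoundaryBubble_edgeBubble {b : AffineBasis (Fin 3) ℝ Plane} (hb : Set.range b = T)
    (he : ({b 1, b 2} : Finset Plane) ∈ boundaryEdges K T) (a : ℕ → ℝ) :
    IsBoundaryBubble k K T (edgeBubble b k a) :=
  ⟨isPoly_edgeBubble b k a, Or.inr ⟨b, hb, he, fun _ => edgeBubble_of_coord_one,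
    fun _ => edgeBubble_of_coord_two⟩⟩

theorem IsBoundaryBubble.eq_zero_of_mem {r : Plane → ℝ} (h : IsBoundaryBubble k K T r) {x : Plane}
    (hx : x ∈ T) : r x = 0 := by
  rcases h.2 with rfl | ⟨b, hb, -, h1, h2⟩
  · rfl
  · have hx' : x ∈ Set.range b := by rw [hb]; exact hx
    obtain ⟨i, rfl⟩ := hx'
    fin_cases i
    · exact h1 _ (b.coord_apply_ne (by decide))
    · exact h2 _ (b.coord_apply_ne (by decide))
    · exact h1 _ (b.coord_apply_ne (by decide))

theorem setIntegral_gradient_zero (T : Finset Plane) :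
    ∫ x in hull T, ‖gradient (0 : Plane → ℝ) x‖ ^ 2 = 0 := by
  simp [norm_gradient]

/-- Small corrections on the triangles of a fine mesh, from zeros at the nodes on `∂Ω` to zeros on
the boundary of the mesh, and conversely. -/
theorem IsCkDomain.exists_boundaryBubble (hk : 2 ≤ k) (hΩ : IsCkDomain k Ω) (γ : ℝ) :
    ∃ h₀ > 0, ∀ K, IsMesh Ω γ K → meshSize K ≤ h₀ → ∀ T ∈ triangles K, ∀ p, IsPoly k p →
      ((∀ P, IsCurvedNode Ω k K T P → p P = 0) → (∀ x ∈ T, x ∈ frontier K.space → p x = 0) →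
        ∃ r, IsBoundaryBubble k K T r ∧
          ∫ x in hull T, ‖gradient r x‖ ^ 2 ≤ 1 / 4 * ∫ x in hull T, ‖gradient p x‖ ^ 2 ∧
          ∀ e ∈ boundaryEdges K T, ∀ x ∈ hull e, p x = r x) ∧
      ((∀ e ∈ boundaryEdges K T, ∀ x ∈ hull e, p x = 0) →
        ∃ r, IsBoundaryBubble k K T r ∧
          ∫ x in hull T, ‖gradient r x‖ ^ 2 ≤ 1 / 4 * ∫ x in hull T, ‖gradient p x‖ ^ 2 ∧
          ∀ P, IsCurvedNode Ω k K T P → p P + r P = 0) := by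
  -- The factor `2 ^ k` bounds `(1 + τ)⁻ᵏ` for `|τ| ≤ 1/2`, needed for the correction at the nodes.
  -- The choice of `η` then ensures `C η² ≤ 1/4`.
  obtain ⟨C, hC, HC⟩ := exists_integral_gradient_edgeBubble_le k (2 * γ) (2 ^ k) (by positivity)
  set η : ℝ := min (1 / 2) (1 / (2 * (C + 1))) with hη
  have hη0 : 0 < η := by positivity
  have hη2 : η ≤ 1 / 2 := min_le_left _ _
  have hCη : C * η ^ 2 ≤ 1 / 4 := by
    have h1 : η ≤ 1 / (2 * (C + 1)) := min_le_right _ _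
    calc C * η ^ 2 ≤ C * (1 / (2 * (C + 1))) ^ 2 := by gcongr
      _ = C / (4 * (C + 1) ^ 2) := by field_simp; norm_num
      _ ≤ 1 / 4 := by
        rw [div_le_div_iff₀ (by positivity) (by norm_num)]; nlinarith
  obtain ⟨h₀, hh₀, H⟩ := hΩ.exists_nodes hk γ hη0
  refine ⟨h₀, hh₀, fun K hK hsize T hT p hp => ?_⟩
  have hnn : 0 ≤ ∫ x in hull T, ‖gradient p x‖ ^ 2 := integral_nonneg fun x => sq_nonneg _
  rcases (boundaryEdges K T).eq_empty_or_nonempty with hempty | ⟨e, he⟩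
  · have hint : ∫ x in hull T, ‖gradient (0 : Plane → ℝ) x‖ ^ 2 ≤
        1 / 4 * ∫ x in hull T, ‖gradient p x‖ ^ 2 := by
      rw [setIntegral_gradient_zero]; positivity
    refine ⟨fun _ _ => ⟨0, isBoundaryBubble_zero, hint, by simp [hempty]⟩,
      fun _ => ⟨0, isBoundaryBubble_zero, hint, ?_⟩⟩
    rintro P ⟨e, he, -⟩
    simp [hempty] at he
  obtain ⟨b, τ, hb, rfl, hτ, hnode⟩ := H K hK hsize T hT e he
  obtain ⟨z, r, hr, hball, hdiam⟩ := hK.exists_closedBall_subset hT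
  have hhull : hull T = convexHull ℝ (Set.range b) := by rw [hb, hull]
  have hk0 : (0 : ℝ) < k := by exact_mod_cast (by omega : 0 < k)
  have hbT : ∀ i, b i ∈ T := fun i => by
    have : b i ∈ (T : Set Plane) := hb ▸ Set.mem_range_self i
    exact this
  have hmem : ∀ i, b i ∈ hull T := fun i => subset_convexHull ℝ _ (hbT i)
  have hIcc : ∀ j ≤ k, (j : ℝ) / k ∈ Set.Icc (0 : ℝ) 1 := fun j hj =>
    ⟨by positivity, by rw [div_le_one hk0]; exact_mod_cast hj⟩
  have hMe : ∀ j ≤ k, edgePoint b k j ∈ hull {b 1, b 2} := fun j hj => by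
    rw [hull_pair, segment_eq_image_lineMap]
    exact ⟨_, hIcc j hj, rfl⟩
  have hMT : ∀ j ≤ k, edgePoint b k j ∈ hull T := fun j hj =>
    convexHull_mono (by exact_mod_cast he.1) (hMe j hj)
  set P : ℕ → Plane := fun j => edgePoint b k j + τ j • (edgePoint b k j - b 0) with hP
  have hdist : ∀ j ≤ k, dist (P j) (edgePoint b k j) ≤ η * diamT T := by
    intro j hj
    rw [hP, dist_self_add_left, norm_smul, Real.norm_eq_abs, ← dist_eq_norm]
    gcongr
    · exact hτ j
    · exact Metric.dist_le_diam_of_mem (isCompact_hull T).isBounded (hMT j hj) (hmem 0)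
  have hbound : ∀ a : ℕ → ℝ, (∀ j ∈ Finset.Ioo 0 k,
      |a j| ≤ 2 ^ k * |p (P j) - p (edgePoint b k j)|) →
      ∫ x in hull T, ‖gradient (edgeBubble b k a) x‖ ^ 2 ≤
        1 / 4 * ∫ x in hull T, ‖gradient p x‖ ^ 2 := by
    intro a ha
    have h1 := HC b z r hr (hhull ▸ hball) (hhull ▸ hdiam) p hp η hη0.le (by linarith) a
      fun j hj => ⟨edgePoint b k j, hhull ▸ hMT j (Finset.mem_Ioo.1 hj).2.le, P j,
        hhull ▸ hdist j (Finset.mem_Ioo.1 hj).2.le, ha j hj⟩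
    rw [← hhull] at h1
    exact h1.trans (by gcongr)
  constructor
  · intro hpn hpv
    have hnodes : ∀ j ∈ Finset.Ioo 0 k, p (P j) = 0 := fun j hj => hpn _ ((hnode _).2 ⟨j, hj, rfl⟩)
    -- As `p` vanishes at the nodes, these values are increments of `p` from node to edge point. The
    -- difference of `p` and the bubble vanishes at `k + 1` points of the edge, ends included, hence
    -- on all of it.
    set a : ℕ → ℝ := fun j => p (edgePoint b k j) with ha
    refine ⟨edgeBubble b k a, isBoundaryBubble_edgeBubble hb he a, hbound a fun j hj => ?_, ?_⟩
    · rw [hnodes j hj, zero_sub, abs_neg]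
      exact le_mul_of_one_le_left (abs_nonneg _) (one_le_pow₀ (by norm_num))
    · intro e' he' x hx
      obtain rfl := hK.boundaryEdges_subsingleton T hT he he'
      rw [hull_pair, segment_eq_image_lineMap] at hx
      obtain ⟨t, -, rfl⟩ := hx
      rw [← sub_eq_zero]
      refine (hp.sub (isPoly_edgeBubble b k a)).eq_zero_on_line (by omega) (fun l hl => ?_) t
      rcases Nat.eq_zero_or_pos l with rfl | hl0
      · simp only [Nat.cast_zero, zero_div, AffineMap.lineMap_apply_zero]
        rw [hpv _ (hbT 1) (he.2.2 (subset_convexHull ℝ _ (by simp))),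
          edgeBubble_of_coord_two (b.coord_apply_ne (by decide)), sub_zero]
      rcases hl.eq_or_lt with rfl | hlk
      · rw [div_self hk0.ne', AffineMap.lineMap_apply_one]
        rw [hpv _ (hbT 2) (he.2.2 (subset_convexHull ℝ _ (by simp))),
          edgeBubble_of_coord_one (b.coord_apply_ne (by decide)), sub_zero]
      · exact sub_eq_zero.2 (edgeBubble_edgePoint b a (Finset.mem_Ioo.2 ⟨hl0, hlk⟩)).symm
  · intro hpe
    have h1τ : ∀ j, 1 / 2 ≤ 1 + τ j := fun j => by
      have := (abs_le.1 (hτ j)).1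
      linarith
    -- By homogeneity the bubble is then `-p` at the nodes. As `p` vanishes on the edge, these
    -- coefficients are again controlled by increments of `p`.
    set a : ℕ → ℝ := fun j => -((1 + τ j) ^ k)⁻¹ * p (P j) with ha
    refine ⟨edgeBubble b k a, isBoundaryBubble_edgeBubble hb he a, hbound a fun j hj => ?_, ?_⟩
    · rw [hpe _ he _ (hMe j (Finset.mem_Ioo.1 hj).2.le), sub_zero, ha, abs_mul, abs_neg, abs_inv,
        abs_pow, abs_of_pos (by linarith [h1τ j])]
      gcongr
      rw [← inv_pow]
      have h2 : (1 + τ j)⁻¹ ≤ 2 := by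
        rw [inv_le_comm₀ (by linarith [h1τ j]) (by norm_num)]
        linarith [h1τ j]
      gcongr
      exact inv_nonneg.2 (by linarith [h1τ j])
    · intro Q hQ
      obtain ⟨j, hj, rfl⟩ := (hnode Q).1 hQ
      rw [edgeBubble_ray b a hj]
      have : (1 + τ j) ^ k ≠ 0 := pow_ne_zero _ (by linarith [h1τ j])
      simp only [ha, hP]
      field_simp
      ring

namespace IsMesh

variable (hK : IsMesh Ω γ K)
include hK

/-- Gluing corrections on the triangles. -/
theorem exists_glue_boundaryBubble (hu : u ∈ piecewisePoly k K)
    {Q : Finset Plane → (Plane → ℝ) → (Plane → ℝ) → Prop}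
    (h : ∀ T ∈ triangles K, ∃ p r, IsPoly k p ∧ Set.EqOn u p (hull T) ∧
      IsBoundaryBubble k K T r ∧
      ∫ x in hull T, ‖gradient r x‖ ^ 2 ≤ 1 / 4 * ∫ x in hull T, ‖gradient p x‖ ^ 2 ∧ Q T p r) :
    ∃ g : Plane → ℝ, (∀ x ∉ K.space, g x = 0) ∧ ContinuousOn g K.space ∧
      (∀ x ∈ K.vertices, g x = 0) ∧ gradNorm K g ≤ 1 / 2 * gradNorm K u ∧
      ∀ T ∈ triangles K, ∃ p r, IsPoly k p ∧ IsPoly k r ∧ Set.EqOn u p (hull T) ∧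
        Set.EqOn g r (hull T) ∧ Q T p r := by
  choose! p r hp hup hr hint hQ using h
  obtain ⟨g, hg0, hgc, hgr⟩ := hK.exists_glue_of_boundary r (fun T hT => (hr T hT).1.continuous)
    fun T hT => (hr T hT).2
  have hgP : g ∈ piecewisePoly k K := fun T hT => ⟨r T, (hr T hT).1, hgr T hT⟩
  refine ⟨g, hg0, hgc, fun x hx => ?_, hK.gradNorm_le_half hgP hu fun T hT => ?_,
    fun T hT => ⟨p T, r T, hp T hT, (hr T hT).1, hup T hT, hgr T hT, hQ T hT⟩⟩
  · obtain ⟨T, hT, hxT⟩ := hK.pure {x} hx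
    have hx' : x ∈ T := hxT (by simp)
    rw [hgr T hT (subset_convexHull ℝ _ hx'), (hr T hT).eq_zero_of_mem hx']
  · rw [setIntegral_norm_gradient_sq_congr (hgr T hT), setIntegral_norm_gradient_sq_congr (hup T hT)]
    exact hint T hT

end IsMesh

/-- On a fine mesh, each function in `W` is close to a function in `V` and conversely. -/
theorem IsCkDomain.exists_approximation (hk : 2 ≤ k) (hΩ : IsCkDomain k Ω) (γ : ℝ) :
    ∃ h₀ > 0, ∀ K, IsMesh Ω γ K → meshSize K ≤ h₀ →
      (∀ w ∈ W Ω k K, ∃ v ∈ V k K, gradNorm K (w - v) ≤ 1 / 2 * gradNorm K w) ∧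
      ∀ v ∈ V k K, ∃ w ∈ W Ω k K, gradNorm K (w - v) ≤ 1 / 2 * gradNorm K v := by
  obtain ⟨h₀, hh₀, H⟩ := hΩ.exists_boundaryBubble hk γ
  refine ⟨h₀, hh₀, fun K hK hsize => ⟨fun w hw => ?_, fun v hv => ?_⟩⟩
  · obtain ⟨g, hg0, hgc, hgv, hgn, hgT⟩ := hK.exists_glue_boundaryBubble
      (Q := fun T p r => ∀ e ∈ boundaryEdges K T, ∀ x ∈ hull e, p x = r x)
      (W_le_piecewisePoly Ω k K hw) (by
        intro T hT
        obtain ⟨p, hp, hwp, hpn⟩ := hw.2.2.2 T hT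
        obtain ⟨r, hr⟩ := (H K hK hsize T hT p hp).1 hpn fun x hx hxf => by
          rw [← hwp (subset_convexHull ℝ _ hx)]
          exact hw.2.2.1 x (mem_vertices_of_mem hT hx) hxf
        exact ⟨p, r, hp, hwp, hr⟩)
    refine ⟨w - g, ⟨fun x hx => ?_, hw.2.1.sub hgc, fun x hx => ?_, fun T hT => ?_⟩, ?_⟩
    · simp [hw.1 x hx, hg0 x hx]
    · rcases hK.mem_vertices_or_mem_boundaryEdge hx with hxv | ⟨T, hT, e, he, hxe⟩
      · simp [hw.2.2.1 x hxv hx, hgv x hxv]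
      · obtain ⟨p, r, hp, hr, hwp, hgr, hpr⟩ := hgT T hT
        have hxT : x ∈ hull T := convexHull_mono (by exact_mod_cast he.1) hxe
        simp [hwp hxT, hgr hxT, hpr e he x hxe]
    · obtain ⟨p, r, hp, hr, hwp, hgr, -⟩ := hgT T hT
      exact ⟨_, hp.sub hr, fun x hx => by simp [hwp hx, hgr hx]⟩
    · rwa [sub_sub_cancel]
  -- The node condition concerns polynomials possibly off their triangle, where the glued function
  -- does not determine them directly; `Q` carries it through the gluing.
  · obtain ⟨g, hg0, hgc, hgv, hgn, hgT⟩ := hK.exists_glue_boundaryBubble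
      (Q := fun T p r => ∀ P, IsCurvedNode Ω k K T P → p P + r P = 0)
      (V_le_piecewisePoly k K hv) (by
        intro T hT
        obtain ⟨p, hp, hvp⟩ := hv.2.2.2 T hT
        obtain ⟨r, hr⟩ := (H K hK hsize T hT p hp).2 fun e he x hx => by
          rw [← hvp (convexHull_mono (by exact_mod_cast he.1) hx)]
          exact hv.2.2.1 x (he.2.2 hx)
        exact ⟨p, r, hp, hvp, hr⟩)
    refine ⟨v + g, ⟨fun x hx => ?_, hv.2.1.add hgc, fun x hxv hx => ?_, fun T hT => ?_⟩, ?_⟩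
    · simp [hv.1 x hx, hg0 x hx]
    · simp [hv.2.2.1 x hx, hgv x hxv]
    · obtain ⟨p, r, hp, hr, hvp, hgr, hpr⟩ := hgT T hT
      exact ⟨_, hp.add hr, fun x hx => by simp [hvp hx, hgr hx], hpr⟩
    · rwa [add_sub_cancel_left]

end Approximation

/-! ### Linear algebra for the variational problem -/

section Duality

variable {K : Geometry.SimplicialComplex ℝ Plane} {k : ℕ} {Ω : Set Plane} {γ : ℝ}

/-- Evaluation of polynomials on a set. -/
def evalOn (s : Set Plane) : MvPolynomial (Fin 2) ℝ →ₗ[ℝ] (s → ℝ) where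
  toFun q x := MvPolynomial.eval (fun i => (x : Plane) i) q
  map_add' p q := by ext; simp
  map_smul' c q := by ext; simp [MvPolynomial.smul_eval]

/-- Restriction to the triangles embeds the space into a finite product of spaces of polynomial
functions. This makes every functional on the dual an evaluation. -/
theorem IsMesh.finiteDimensional_V (hK : IsMesh Ω γ K) (k : ℕ) : FiniteDimensional ℝ (V k K) := by
  have : Finite (triangles K) := hK.finite_triangles
  let E : ∀ T : triangles K, Submodule ℝ (hull T → ℝ) := fun T =>
    (MvPolynomial.restrictTotalDegree (Fin 2) ℝ k).map (evalOn (hull T))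
  let Φ : V k K →ₗ[ℝ] ∀ T : triangles K, E T := LinearMap.pi fun T =>
    LinearMap.codRestrict (E T) (LinearMap.funLeft ℝ ℝ (Subtype.val : hull T → Plane) ∘ₗ
      (V k K).subtype) fun v => by
        obtain ⟨p, ⟨q, hq, hpq⟩, hvp⟩ := v.2.2.2.2 T T.2
        refine ⟨q, (MvPolynomial.mem_restrictTotalDegree _ _ _).2 hq, ?_⟩
        ext x
        exact ((hvp x.2).trans (hpq x)).symm
  refine FiniteDimensional.of_injective Φ ((injective_iff_map_eq_zero Φ).2 fun v hv => ?_)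
  ext x
  by_cases hx : x ∈ K.space
  · obtain ⟨T, hT, hxT⟩ := hK.mem_space_iff.1 hx
    have h1 := congrArg Subtype.val (congrFun hv ⟨T, hT⟩)
    exact congrFun h1 ⟨x, hxT⟩
  · exact v.2.1 x hx

/-- The load as a linear functional. -/
def loadL (hK : IsMesh Ω γ K) (k : ℕ) (f : Plane → ℝ) (hf : IntegrableOn f K.space) :
    V k K →ₗ[ℝ] ℝ where
  toFun v := load K f v
  map_add' v w := by
    have h : ∀ v : V k K, IntegrableOn (fun x => f x * (v : Plane → ℝ) x) K.space := fun v =>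
      hf.mul_continuousOn v.2.2.1 hK.isCompact_space
    simp only [load, Submodule.coe_add, Pi.add_apply, mul_add]
    exact integral_add (h v) (h w)
  map_smul' c v := by
    simp only [load, Submodule.coe_smul, Pi.smul_apply, smul_eq_mul, RingHom.id_apply]
    rw [← integral_const_mul]
    exact integral_congr_ae (Filter.Eventually.of_forall fun x => by ring)

/-- Cauchy–Schwarz in `⟪x, y⟫ = ‖x‖² - ⟪x, x - y⟫`. -/
theorem half_sq_le_inner_of_norm_sub_le {E : Type*} [NormedAddCommGroup E] [InnerProductSpace ℝ E]
    {x y : E} (h : ‖x - y‖ ≤ 1 / 2 * ‖x‖) : 1 / 2 * ‖x‖ ^ 2 ≤ inner ℝ x y := by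
  have h1 : inner ℝ x y = ‖x‖ ^ 2 - inner ℝ x (x - y) := by
    rw [inner_sub_right, real_inner_self_eq_norm_sq]; ring
  have h2 := real_inner_le_norm x (x - y)
  nlinarith [norm_nonneg x]

end Duality

end CurvedFEM

end

/-! ### Unique solvability and the inf-sup condition -/

open CurvedFEM in
theorem proposition2p1 (k : ℕ) (hk : 2 ≤ k) (Ω : Set CurvedFEM.Plane)
    (hΩ : CurvedFEM.IsCkDomain k Ω) (γ : ℝ) :
    ∃ h₀ : ℝ, 0 < h₀ ∧
      ∀ K : Geometry.SimplicialComplex ℝ CurvedFEM.Plane,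
        CurvedFEM.IsMesh Ω γ K → CurvedFEM.meshSize K ≤ h₀ →
        (∀ f : CurvedFEM.Plane → ℝ, MeasureTheory.IntegrableOn f K.space →
          ∃! u : CurvedFEM.Plane → ℝ, u ∈ CurvedFEM.W Ω k K ∧
            ∀ v ∈ CurvedFEM.V k K, CurvedFEM.aForm K u v = CurvedFEM.load K f v) ∧
        ∀ w ∈ CurvedFEM.W Ω k K, w ≠ 0 →
          ∃ s : ℝ,
            IsLUB {q : ℝ | ∃ v ∈ CurvedFEM.V k K, v ≠ 0 ∧
              q = CurvedFEM.aForm K w v /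
                (CurvedFEM.gradNorm K w * CurvedFEM.gradNorm K v)} s ∧
            1 / 3 ≤ s := by
  obtain ⟨h₀, hh₀, H⟩ := hΩ.exists_approximation hk γ
  refine ⟨h₀, hh₀, fun K hK hsize => ?_⟩
  obtain ⟨HW, HV⟩ := H K hK hsize
  let GW := hK.gradL2 k ∘ₗ Submodule.inclusion (W_le_piecewisePoly Ω k K)
  let GV := hK.gradL2 k ∘ₗ Submodule.inclusion (V_le_piecewisePoly k K)
  have hform : ∀ (w : W Ω k K) (v : V k K), aForm K w v = inner ℝ (GW w) (GV v) := fun w v =>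
    hK.aForm_eq_inner (Submodule.inclusion (W_le_piecewisePoly Ω k K) w)
      (Submodule.inclusion (V_le_piecewisePoly k K) v)
  have hnW : ∀ w : W Ω k K, gradNorm K w = ‖GW w‖ := fun w =>
    hK.gradNorm_eq_norm (Submodule.inclusion (W_le_piecewisePoly Ω k K) w)
  have hnV : ∀ v : V k K, gradNorm K v = ‖GV v‖ := fun v =>
    hK.gradNorm_eq_norm (Submodule.inclusion (V_le_piecewisePoly k K) v)
  have hnsub : ∀ (w : W Ω k K) (v : V k K),
      gradNorm K ((w : Plane → ℝ) - v) = ‖GW w - GV v‖ := fun w v => by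
    have h := hK.gradNorm_eq_norm (Submodule.inclusion (W_le_piecewisePoly Ω k K) w -
      Submodule.inclusion (V_le_piecewisePoly k K) v)
    rw [map_sub] at h
    exact h
  have hposW : ∀ w : W Ω k K, w ≠ 0 → 0 < ‖GW w‖ := fun w hw =>
    (norm_nonneg _).lt_of_ne fun h => hw (Subtype.ext (hK.eq_zero_of_gradNorm_eq_zero
      (W_le_piecewisePoly Ω k K w.2) w.2.1 w.2.2.2.1 (by rw [hnW, ← h])))
  have hposV : ∀ v : V k K, v ≠ 0 → 0 < ‖GV v‖ := fun v hv =>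
    (norm_nonneg _).lt_of_ne fun h => hv (Subtype.ext (hK.eq_zero_of_gradNorm_eq_zero
      (V_le_piecewisePoly k K v.2) v.2.1 (fun x _ hx => v.2.2.2.1 x hx) (by rw [hnV, ← h])))
  have hW : ∀ w : W Ω k K, ∃ v : V k K, ‖GW w - GV v‖ ≤ 1 / 2 * ‖GW w‖ := fun w => by
    obtain ⟨v, hv, h⟩ := HW w w.2
    exact ⟨⟨v, hv⟩, by rw [← hnsub, ← hnW]; exact h⟩
  have hV : ∀ v : V k K, ∃ w : W Ω k K, ‖GV v - GW w‖ ≤ 1 / 2 * ‖GV v‖ := fun v => by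
    obtain ⟨w, hw, h⟩ := HV v v.2
    exact ⟨⟨w, hw⟩, by rw [norm_sub_rev, ← hnsub, ← hnV]; exact h⟩
  refine ⟨fun f hf => ?_, fun w hw hw0 => ?_⟩
  · have := hK.finiteDimensional_V k
    let A : W Ω k K →ₗ[ℝ] Module.Dual ℝ (V k K) := (innerₗ _).compl₁₂ GW GV
    have hA : ∀ w v, A w v = inner ℝ (GW w) (GV v) := fun w v => rfl
    -- A proper range would be annihilated by evaluation at some `v ≠ 0`, while the `w` close to `v`
    -- satisfies `a(w, v) ≥ ½ ‖grad v‖² > 0`.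
    have hsurj : LinearMap.range A = ⊤ := by
      by_contra hne
      obtain ⟨φ, hφ, hker⟩ := Submodule.exists_le_ker_of_lt_top _ (lt_top_iff_ne_top.2 hne)
      obtain ⟨v, rfl⟩ := (Module.evalEquiv ℝ (V k K)).surjective φ
      have hv : v ≠ 0 := by rintro rfl; simp at hφ
      obtain ⟨w, hw⟩ := hV v
      have h1 : A w v = 0 := hker (LinearMap.mem_range_self A w)
      have h2 := half_sq_le_inner_of_norm_sub_le hw
      rw [hA, real_inner_comm] at h1
      rw [h1] at h2
      nlinarith [hposV v hv]
    obtain ⟨u, hu⟩ := LinearMap.range_eq_top.1 hsurj (loadL hK k f hf)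
    have huv : ∀ v : V k K, aForm K u v = load K f v := fun v => by
      rw [hform, ← hA, hu]; rfl
    refine ⟨u, ⟨u.2, fun v hv => huv ⟨v, hv⟩⟩, ?_⟩
    rintro u' ⟨hu', hu'v⟩
    by_contra hne
    have hd : (⟨u', hu'⟩ - u : W Ω k K) ≠ 0 := fun h =>
      hne (congrArg Subtype.val (sub_eq_zero.1 h))
    -- Testing the difference of two solutions with its approximation in `V` forces its gradient to
    -- vanish.
    obtain ⟨v, hv⟩ := hW (⟨u', hu'⟩ - u)
    have h1 := half_sq_le_inner_of_norm_sub_le hv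
    have h2 : inner ℝ (GW (⟨u', hu'⟩ - u)) (GV v) = (0 : ℝ) := by
      rw [map_sub, inner_sub_left, ← hform, ← hform, huv, hu'v v v.2, sub_self]
    rw [h2] at h1
    nlinarith [hposW _ hd]
  · lift w to W Ω k K using hw
    have hw0' : w ≠ 0 := fun h => hw0 (by rw [h]; rfl)
    have hwp := hposW w hw0'
    have hub : ∀ q ∈ {q : ℝ | ∃ v ∈ V k K, v ≠ 0 ∧
        q = aForm K w v / (gradNorm K w * gradNorm K v)}, q ≤ 1 := by
      rintro q ⟨v, hv, -, rfl⟩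
      lift v to V k K using hv
      rw [hform, hnW, hnV]
      exact div_le_one_of_le₀ (real_inner_le_norm _ _) (by positivity)
    obtain ⟨v, hv⟩ := hW w
    have h1 := half_sq_le_inner_of_norm_sub_le hv
    have hv0 : v ≠ 0 := by
      rintro rfl
      rw [map_zero, inner_zero_right] at h1
      nlinarith
    have hvp := hposV v hv0
    have hmem : aForm K w v / (gradNorm K w * gradNorm K v) ∈ {q : ℝ | ∃ v ∈ V k K, v ≠ 0 ∧
        q = aForm K w v / (gradNorm K w * gradNorm K v)} :=
      ⟨v, v.2, fun h => hv0 (Subtype.ext h), rfl⟩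
    obtain ⟨s, hs⟩ := Real.exists_isLUB ⟨_, hmem⟩ ⟨1, hub⟩
    refine ⟨s, hs, le_trans ?_ (hs.1 hmem)⟩
    rw [hform, hnW, hnV, le_div_iff₀ (by positivity)]
    -- With `a(w, v) ≥ ½ ‖grad w‖²` this gives the quotient at least `(1/2) / (3/2) = 1/3`.
    have h2 : ‖GV v‖ ≤ 3 / 2 * ‖GW w‖ := by
      have := norm_sub_norm_le (GV v) (GW w)
      rw [norm_sub_rev] at this
      linarith
    nlinarith
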